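/- There is a polynomial-time $3$-approximation algorithm for the $2$-generalized bottleneck spanning tree problem on points in a metric space. That is, there are a single algorithm $\mathcal{A}$ and a polynomial $p$ with the following property. Let $P$ be any set of $n\ge 1$ points in any metric space, partitioned into $m$ nonempty clusters $C_1,\dots,C_m$, each of size at most $2$. Call a tree feasible if its vertices are points of $P$ and it contains exactly one point from each cluster $C_j$, and let $\lambda(T)$ denote the largest edge length of a tree $T$, where the length of an edge is the distance between its endpoints, and $\lambda(T)=0$ if $T$ has no edge. Given $n$, $m$, the cluster of each point, and access to the distances between the points, $\mathcal{A}$ halts after at most $p(n)$ steps and outputs a feasible tree $T$ with $\lambda(T)\le 3\,\lambda(T')$ for every feasible tree $T'$. Here $\mathcal{A}$ is a program of a unit-cost random access machine with natural numbers as data, whose arithmetic operations are addition and truncated subtraction, and which accesses the distances only by comparing two of them, each comparison being one step. -/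

import Mathlib

/-!
# Random access machine programs with distance comparisons

The computational model is a random access machine with unit cost, presented by structured
programs. A machine has natural number registers and arrays of natural numbers. The integer
operations are constants, copying, addition and truncated subtraction (there is no
multiplication). The points of the input are named by their indices, and their distances are
accessible only through tests "is `d p q ≤ d r s`?".
-/

namespace RAM

/-- A memory state: registers, and arrays of natural numbers (both named by natural numbers;
a program mentions only finitely many names). -/
structure State where
  reg : ℕ → ℕ
  arr : ℕ → ℕ → ℕ

/-- Write the value `v` to the register `x`. -/
def State.setReg (s : State) (x v : ℕ) : State :=
  { s with reg := Function.update s.reg x v }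

/-- Write the value `v` to the cell `i` of the array `a`. -/
def State.setArr (s : State) (a i v : ℕ) : State :=
  { s with arr := Function.update s.arr a (Function.update (s.arr a) i v) }

/-- The elementary tests; the arguments are names of registers. -/
inductive Test where
  | lt (x y : ℕ)
  | eq (x y : ℕ)
  | distLe (p q r t : ℕ)

/-- The truth of a test in a state, for the distance table `d`. -/
def Test.Holds (d : ℕ → ℕ → ℝ) (s : State) : Test → Prop
  | .lt x y => s.reg x < s.reg y
  | .eq x y => s.reg x = s.reg y
  | .distLe p q r t => d (s.reg p) (s.reg q) ≤ d (s.reg r) (s.reg t)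

/-- Programs. In `load x a i` and `store a i x`, `a` names an array, and `x`, `i` are registers,
the register `i` holding the index of the cell (indirect addressing). -/
inductive Program where
  | skip
  | const (x c : ℕ)
  | copy (x y : ℕ)
  | add (x y z : ℕ)
  | sub (x y z : ℕ)
  | load (x a i : ℕ)
  | store (a i x : ℕ)
  | seq (P Q : Program)
  | ite (b : Test) (P Q : Program)
  | while (b : Test) (P : Program)

/-- `Runs d P s k s'`: for the distance table `d`, the program `P`, started in the state `s`,
halts in the state `s'` after exactly `k` steps. Every elementary command and every evaluation
of a test is one step. -/
inductive Runs (d : ℕ → ℕ → ℝ) : Program → State → ℕ → State → Prop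
  | skip (s : State) : Runs d .skip s 1 s
  | const (s : State) (x c : ℕ) : Runs d (.const x c) s 1 (s.setReg x c)
  | copy (s : State) (x y : ℕ) : Runs d (.copy x y) s 1 (s.setReg x (s.reg y))
  | add (s : State) (x y z : ℕ) : Runs d (.add x y z) s 1 (s.setReg x (s.reg y + s.reg z))
  | sub (s : State) (x y z : ℕ) : Runs d (.sub x y z) s 1 (s.setReg x (s.reg y - s.reg z))
  | load (s : State) (x a i : ℕ) : Runs d (.load x a i) s 1 (s.setReg x (s.arr a (s.reg i)))
  | store (s : State) (a i x : ℕ) : Runs d (.store a i x) s 1 (s.setArr a (s.reg i) (s.reg x))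
  | seq {P Q : Program} {s s' s'' : State} {k l : ℕ} :
      Runs d P s k s' → Runs d Q s' l s'' → Runs d (.seq P Q) s (k + l) s''
  | ite_true {b : Test} {P Q : Program} {s s' : State} {k : ℕ} :
      b.Holds d s → Runs d P s k s' → Runs d (.ite b P Q) s (k + 1) s'
  | ite_false {b : Test} {P Q : Program} {s s' : State} {k : ℕ} :
      ¬ b.Holds d s → Runs d Q s k s' → Runs d (.ite b P Q) s (k + 1) s'
  | while_true {b : Test} {P : Program} {s s' s'' : State} {k l : ℕ} :
      b.Holds d s → Runs d P s k s' → Runs d (.while b P) s' l s'' →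
      Runs d (.while b P) s (k + l + 1) s''
  | while_false {b : Test} {P : Program} {s : State} :
      ¬ b.Holds d s → Runs d (.while b P) s 1 s

end RAM

/-- An instance of the `k`-generalized bottleneck spanning tree problem: `n ≥ 1` distinct points
of the metric space `X`, partitioned into `m` nonempty clusters of size at most `k`. -/
structure GBST (k : ℕ) (X : Type*) [MetricSpace X] where
  /-- the number of points -/
  n : ℕ
  /-- the number of clusters -/
  m : ℕ
  n_pos : 0 < n
  /-- the points -/
  pt : Fin n ↪ X
  /-- the cluster that contains a point -/
  cluster : Fin n → Fin m
  cluster_nonempty : Function.Surjective cluster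
  cluster_size : ∀ j : Fin m, (Finset.univ.filter fun i => cluster i = j).card ≤ k

namespace GBST

variable {k : ℕ} {X : Type*} [MetricSpace X]

/-- Graphs on some of the points of the instance: subgraphs of the complete graph. -/
abbrev Graph (I : GBST k X) : Type := (⊤ : SimpleGraph (Fin I.n)).Subgraph

/-- `T` is a tree that contains exactly one point from each cluster. -/
def IsFeasible (I : GBST k X) (T : I.Graph) : Prop :=
  T.coe.IsTree ∧ ∀ j : Fin I.m, ∃! i : Fin I.n, i ∈ T.verts ∧ I.cluster i = j

/-- The largest edge length of `T` (which is `0` if `T` has no edge). -/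
noncomputable def bottleneck (I : GBST k X) (T : I.Graph) : ℝ :=
  sSup {r : ℝ | ∃ a b : Fin I.n, T.Adj a b ∧ r = dist (I.pt a) (I.pt b)}

/-- The table of the distances between the points (`0` outside the range of the indices). -/
noncomputable def distTable (I : GBST k X) (p q : ℕ) : ℝ :=
  if h : p < I.n ∧ q < I.n then dist (I.pt ⟨p, h.1⟩) (I.pt ⟨q, h.2⟩) else 0

/-- The input of the machine: the register `0` holds the number of points, the register `1` the
number of clusters, and the array `0` the cluster of each point. Everything else is `0`. -/
def input (I : GBST k X) : RAM.State where
  reg x := if x = 0 then I.n else if x = 1 then I.m else 0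
  arr a i := if h : a = 0 ∧ i < I.n then (I.cluster ⟨i, h.2⟩ : ℕ) else 0

/-- The state `s` describes the graph `T` as output: the first `m` cells of the array `1` list
the vertices, and the first `m - 1` cells of the arrays `2` and `3` list the two endpoints of the
edges. -/
def IsOutput (I : GBST k X) (s : RAM.State) (T : I.Graph) : Prop :=
  (∀ v : Fin I.n, v ∈ T.verts ↔ ∃ j < I.m, s.arr 1 j = v) ∧
  (∀ a b : Fin I.n, T.Adj a b ↔ ∃ e, e + 1 < I.m ∧
    ((s.arr 2 e = a ∧ s.arr 3 e = b) ∨ (s.arr 2 e = b ∧ s.arr 3 e = a)))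

end GBST

/-! Drop for a moment the requirement that a tree contain only one point of each cluster, and ask
only that it touch every cluster. This relaxed problem is solved exactly. From a fixed root,
repeatedly attach the point nearest to the current tree until all clusters are touched; the longest
edge used is the least possible for that root, and minimizing over all roots gives a tree with
longest edge `lam`, at most the bottleneck of any feasible tree. Optimality is expressed by
`CutBound`, the condition that every non-covering set containing the root can be left by a short
edge. Each added edge obeys every such bound (`Growing.step`), a grown covering tree yields one
(`Grown.cutBound`), and so does a feasible tree (`IsFeasible.exists_cutBound`).

It remains to thin the tree to one point per cluster. Choose a matching of tree edges that covers
every vertex with a child (`matchTree_spec`). Each point lies in at most one matching edge and, as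
clusters have size at most 2, in at most one cluster pair. Cluster pairs and matching edges thus
form paths and even cycles, and an alternating walk along them chooses exactly one tree point per
cluster while meeting every matching edge (`Coloring.step`, `choosePoints_spec`).

The chosen points are connected by edges of length at most `3 * lam` (`TreeMatching.cutBound`).
Replace an unchosen matched vertex by its chosen partner, at distance at most `lam`; the ends of a
tree edge then move to chosen points at most `lam + lam + lam` apart. Unmatched, unchosen vertices
have no children and can be dropped. Growing a nearest-point tree on the chosen points therefore
gives the factor 3.

For the running time, the algorithm is written in a language whose only loops run `n` times. A
compiler to machine programs is verified once (`Cmd.runs_compile`), and a polynomial time bound is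
read off from the syntax. As distances can only be compared, a bottleneck is always represented by
the two endpoints of an edge. -/

namespace RAM

/-! ### A structured language with bounded loops, and its compiler. -/

/-- Expressions over registers and arrays. -/
inductive Expr where
  | var (x : ℕ)
  | lit (c : ℕ)
  | arr (a : ℕ) (e : Expr)
  | add (e f : Expr)
  | sub (e f : Expr)

namespace Expr

/-- The value of an expression. -/
def eval (s : State) : Expr → ℕ
  | var x => s.reg x
  | lit c => c
  | arr a e => s.arr a (e.eval s)
  | add e f => e.eval s + f.eval s
  | sub e f => e.eval s - f.eval s

/-- All registers of the expression are below `100`. The registers from `100` on are reserved for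
the intermediate results of compiled programs. -/
def ok : Expr → Bool
  | var x => decide (x < 100)
  | lit _ => true
  | arr _ e => e.ok
  | add e f => e.ok && f.ok
  | sub e f => e.ok && f.ok

/-- The program that computes an expression into the register `t`, using no register below `t`. -/
def compile : Expr → ℕ → Program
  | var x, t => .copy t x
  | lit c, t => .const t c
  | arr a e, t => .seq (e.compile t) (.load t a t)
  | add e f, t => .seq (e.compile t) (.seq (f.compile (t + 1)) (.add t t (t + 1)))
  | sub e f, t => .seq (e.compile t) (.seq (f.compile (t + 1)) (.sub t t (t + 1)))

/-- The running time of the compiled expression. -/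
def cost : Expr → ℕ
  | var _ => 1
  | lit _ => 1
  | arr _ e => e.cost + 1
  | add e f => e.cost + (f.cost + 1)
  | sub e f => e.cost + (f.cost + 1)

end Expr

/-- Boolean combinations of comparisons of expressions. -/
inductive Cond where
  | lt (e f : Expr)
  | eq (e f : Expr)
  | distLe (e f g h : Expr)
  | and (b c : Cond)
  | not (b : Cond)

namespace Cond

/-- The truth of a condition. -/
def Holds (d : ℕ → ℕ → ℝ) (s : State) : Cond → Prop
  | lt e f => e.eval s < f.eval s
  | eq e f => e.eval s = f.eval s
  | distLe e f g h => d (e.eval s) (f.eval s) ≤ d (g.eval s) (h.eval s)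
  | and b c => b.Holds d s ∧ c.Holds d s
  | not b => ¬ b.Holds d s

/-- All registers of the condition are below `100`. -/
def ok : Cond → Bool
  | lt e f => e.ok && f.ok
  | eq e f => e.ok && f.ok
  | distLe e f g h => (e.ok && f.ok) && (g.ok && h.ok)
  | and b c => b.ok && c.ok
  | not b => b.ok

/-- The program that computes the truth value of a condition into the register `t`. -/
def compile : Cond → ℕ → Program
  | lt e f, t => .seq (e.compile t) (.seq (f.compile (t + 1))
      (.ite (.lt t (t + 1)) (.const t 1) (.const t 0)))
  | eq e f, t => .seq (e.compile t) (.seq (f.compile (t + 1))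
      (.ite (.eq t (t + 1)) (.const t 1) (.const t 0)))
  | distLe e f g h, t => .seq (e.compile t) (.seq (f.compile (t + 1))
      (.seq (g.compile (t + 2)) (.seq (h.compile (t + 3))
      (.ite (.distLe t (t + 1) (t + 2) (t + 3)) (.const t 1) (.const t 0)))))
  | and b c, t => .seq (b.compile t) (.seq (c.compile (t + 1))
      (.seq (.const (t + 2) 1) (.seq (.add t t (t + 1)) (.sub t t (t + 2)))))
  | not b, t => .seq (b.compile t) (.seq (.const (t + 1) 1) (.sub t (t + 1) t))

/-- The running time of the compiled condition. -/
def cost : Cond → ℕ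
  | lt e f => e.cost + (f.cost + (1 + 1))
  | eq e f => e.cost + (f.cost + (1 + 1))
  | distLe e f g h => e.cost + (f.cost + (g.cost + (h.cost + (1 + 1))))
  | and b c => b.cost + (c.cost + (1 + (1 + 1)))
  | not b => b.cost + (1 + 1)

end Cond

/-- Structured commands. The command `loop x c` runs `c` for `x = 0, …, n - 1`, where `n` is the
content of the register `0`. -/
inductive Cmd where
  | skip
  | set (x : ℕ) (e : Expr)
  | store (a : ℕ) (i e : Expr)
  | seq (c c' : Cmd)
  | ite (b : Cond) (c c' : Cmd)
  | loop (x : ℕ) (c : Cmd)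

/-- Apply `f 0`, …, `f (k - 1)` in turn. -/
def iter (f : ℕ → State → State) : ℕ → State → State
  | 0, s => s
  | k + 1, s => f k (iter f k s)

namespace Cmd

open Classical in
/-- The effect of a command. -/
noncomputable def eval (d : ℕ → ℕ → ℝ) : Cmd → State → State
  | skip, s => s
  | set x e, s => s.setReg x (e.eval s)
  | store a i e, s => s.setArr a (i.eval s) (e.eval s)
  | seq c c', s => c'.eval d (c.eval d s)
  | ite b c c', s => if b.Holds d s then c.eval d s else c'.eval d s
  | loop x c, s => (iter (fun i t => c.eval d (t.setReg x i)) (s.reg 0) s).setReg x (s.reg 0)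

lemma eval_seq (d : ℕ → ℕ → ℝ) (c c' : Cmd) (s : State) :
    (seq c c').eval d s = c'.eval d (c.eval d s) := rfl

lemma eval_set (d : ℕ → ℕ → ℝ) (x : ℕ) (e : Expr) (s : State) :
    (set x e).eval d s = s.setReg x (e.eval s) := rfl

lemma eval_ite_pos {d : ℕ → ℕ → ℝ} {b : Cond} {s : State} (h : b.Holds d s) (c c' : Cmd) :
    (ite b c c').eval d s = c.eval d s := by rw [eval, if_pos h]

lemma eval_ite_neg {d : ℕ → ℕ → ℝ} {b : Cond} {s : State} (h : ¬ b.Holds d s) (c c' : Cmd) :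
    (ite b c c').eval d s = c'.eval d s := by rw [eval, if_neg h]

/-- The registers that a command may change. -/
def regs : Cmd → List ℕ
  | skip => []
  | set x _ => [x]
  | store _ _ _ => []
  | seq c c' => c.regs ++ c'.regs
  | ite _ c c' => c.regs ++ c'.regs
  | loop x c => x :: c.regs

/-- The arrays that a command may change. -/
def arrs : Cmd → List ℕ
  | skip => []
  | set _ _ => []
  | store a _ _ => [a]
  | seq c c' => c.arrs ++ c'.arrs
  | ite _ c c' => c.arrs ++ c'.arrs
  | loop _ c => c.arrs

/-- A command is well formed if it does not use the reserved registers, does not change the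
register `0`, and if no loop body changes its loop register. -/
def ok : Cmd → Bool
  | skip => true
  | set x e => e.ok && decide (0 < x ∧ x < 100)
  | store _ i e => i.ok && e.ok
  | seq c c' => c.ok && c'.ok
  | ite b c c' => b.ok && (c.ok && c'.ok)
  | loop x c => c.ok && decide (0 < x ∧ x < 100 ∧ x ∉ c.regs)

/-- The program of a command. -/
def compile : Cmd → Program
  | skip => .skip
  | set x e => .seq (e.compile 100) (.copy x 100)
  | store a i e => .seq (i.compile 100) (.seq (e.compile 101) (.store a 100 101))
  | seq c c' => .seq c.compile c'.compile
  | ite b c c' => .seq (b.compile 100)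
      (.seq (.const 101 0) (.ite (.lt 101 100) c.compile c'.compile))
  | loop x c => .seq (.const x 0)
      (.while (.lt x 0) (.seq c.compile (.seq (.const 100 1) (.add x x 100))))

open Polynomial in
/-- A polynomial bound for the running time of the program of a command. -/
noncomputable def cost : Cmd → ℕ[X]
  | skip => 1
  | set _ e => C (e.cost + 1)
  | store _ i e => C (i.cost + (e.cost + 1))
  | seq c c' => c.cost + c'.cost
  | ite b c c' => C (b.cost + 2) + (c.cost + c'.cost)
  | loop _ c => 2 + X * (c.cost + 3)

end Cmd

@[simp] lemma State.setReg_reg (s : State) (x v y : ℕ) :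
    (s.setReg x v).reg y = if y = x then v else s.reg y := by
  simp [State.setReg, Function.update_apply]

@[simp] lemma State.setReg_arr (s : State) (x v : ℕ) : (s.setReg x v).arr = s.arr := rfl

@[simp] lemma State.setArr_reg (s : State) (a i v : ℕ) : (s.setArr a i v).reg = s.reg := rfl

lemma State.setArr_arr (s : State) (a i v b : ℕ) :
    (s.setArr a i v).arr b = if b = a then Function.update (s.arr b) i v else s.arr b := by
  by_cases h : b = a
  · subst h; simp [State.setArr]
  · simp [State.setArr, h]

@[simp] lemma State.setArr_arr_apply (s : State) (a i v b j : ℕ) :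
    (s.setArr a i v).arr b j = if b = a ∧ j = i then v else s.arr b j := by
  rw [State.setArr_arr]
  by_cases h : b = a <;> simp [h, Function.update_apply]

/-! ### Correctness of compilation -/

/-- Two states agree up to the reserved registers. -/
def Agree (s t : State) : Prop := t.arr = s.arr ∧ ∀ x < 100, t.reg x = s.reg x

/-- `t'` arises from `t` by writing `v` to the register `i`, up to registers above `i`. -/
def Puts (t : State) (i v : ℕ) (t' : State) : Prop :=
  t'.arr = t.arr ∧ t'.reg i = v ∧ ∀ x < i, t'.reg x = t.reg x

lemma Puts.agree {s t t' : State} {i v : ℕ} (h : Puts t i v t') (hi : 100 ≤ i) (hs : Agree s t) :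
    Agree s t' :=
  ⟨h.1.trans hs.1, fun x hx => (h.2.2 x (by omega)).trans (hs.2 x hx)⟩

/-- The registers from `i` on act as a stack: the second operand is computed at `i + 1`, so the
first survives in `i`. Source registers lie below 100 and are never disturbed. -/
lemma Expr.runs_compile (d : ℕ → ℕ → ℝ) {s : State} (e : Expr) (he : e.ok) (i : ℕ) (hi : 100 ≤ i)
    (t : State) (hs : Agree s t) :
    ∃ t', Runs d (e.compile i) t e.cost t' ∧ Puts t i (e.eval s) t' := by
  induction e generalizing i t with
  | var x =>
    have hx : x < 100 := by simpa [Expr.ok] using he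
    exact ⟨_, Runs.copy _ _ _, rfl, by simp [Expr.eval, hs.2 x hx], fun y hy => by
      simp [hy.ne]⟩
  | lit c => exact ⟨_, Runs.const _ _ _, rfl, by simp [Expr.eval], fun y hy => by simp [hy.ne]⟩
  | arr a e ih =>
    obtain ⟨t', h, p⟩ := ih he i hi t hs
    refine ⟨_, h.seq (Runs.load _ _ _ _), p.1, ?_, fun y hy => ?_⟩
    · simp [Expr.eval, p.1, hs.1, p.2.1]
    · simp [hy.ne, p.2.2 y hy]
  | add e f ihe ihf =>
    simp only [Expr.ok, Bool.and_eq_true] at he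
    obtain ⟨t', h, p⟩ := ihe he.1 i hi t hs
    obtain ⟨t'', h', p'⟩ := ihf he.2 (i + 1) (by omega) t' (p.agree hi hs)
    refine ⟨_, h.seq (h'.seq (Runs.add _ _ _ _)), p'.1.trans p.1, ?_, fun y hy => ?_⟩
    · simp [Expr.eval, p'.2.1, p'.2.2 i (by omega), p.2.1]
    · simp [hy.ne, p'.2.2 y (by omega), p.2.2 y hy]
  | sub e f ihe ihf =>
    simp only [Expr.ok, Bool.and_eq_true] at he
    obtain ⟨t', h, p⟩ := ihe he.1 i hi t hs
    obtain ⟨t'', h', p'⟩ := ihf he.2 (i + 1) (by omega) t' (p.agree hi hs)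
    refine ⟨_, h.seq (h'.seq (Runs.sub _ _ _ _)), p'.1.trans p.1, ?_, fun y hy => ?_⟩
    · simp [Expr.eval, p'.2.1, p'.2.2 i (by omega), p.2.1]
    · simp [hy.ne, p'.2.2 y (by omega), p.2.2 y hy]

lemma Runs.truth_value {d : ℕ → ℕ → ℝ} (b : Test) (i : ℕ) (t : State) :
    ∃ t' v, Runs d (.ite b (.const i 1) (.const i 0)) t (1 + 1) t' ∧ Puts t i v t' ∧
      v ≤ 1 ∧ (v = 1 ↔ b.Holds d t) := by
  by_cases h : b.Holds d t
  · exact ⟨_, 1, Runs.ite_true h (Runs.const _ _ _), ⟨rfl, by simp, fun y hy => by simp [hy.ne]⟩,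
      le_rfl, by simp [h]⟩
  · exact ⟨_, 0, Runs.ite_false h (Runs.const _ _ _), ⟨rfl, by simp, fun y hy => by simp [hy.ne]⟩,
      by simp, by simp [h]⟩

lemma Puts.trans {t t' t'' : State} {i j v w : ℕ} (h : Puts t i v t') (h' : Puts t' j w t'')
    (hij : j ≤ i) : Puts t j w t'' :=
  ⟨h'.1.trans h.1, h'.2.1, fun x hx => (h'.2.2 x hx).trans (h.2.2 x (by omega))⟩

/-- Truth values are kept in `{0, 1}`, so that conjunction becomes the truncated `v + w - 1` and
negation becomes `1 - v`. -/
lemma Cond.runs_compile (d : ℕ → ℕ → ℝ) {s : State} (b : Cond) (hb : b.ok) (i : ℕ) (hi : 100 ≤ i)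
    (t : State) (hs : Agree s t) :
    ∃ t' v, Runs d (b.compile i) t b.cost t' ∧ Puts t i v t' ∧ v ≤ 1 ∧ (v = 1 ↔ b.Holds d s) := by
  induction b generalizing i t with
  | lt e f =>
    simp only [Cond.ok, Bool.and_eq_true] at hb
    obtain ⟨t₁, h₁, p₁⟩ := e.runs_compile d hb.1 i hi t hs
    have a₁ := p₁.agree hi hs
    obtain ⟨t₂, h₂, p₂⟩ := f.runs_compile d hb.2 (i + 1) (by omega) t₁ a₁
    obtain ⟨t₃, v, h₃, p₃, hv, hv'⟩ := Runs.truth_value (d := d) (.lt i (i + 1)) i t₂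
    refine ⟨t₃, v, h₁.seq (h₂.seq h₃), p₁.trans (p₂.trans p₃ (by omega)) le_rfl, hv, ?_⟩
    simp [hv', Test.Holds, Cond.Holds, p₂.2.1, p₂.2.2 i (by omega), p₁.2.1]
  | eq e f =>
    simp only [Cond.ok, Bool.and_eq_true] at hb
    obtain ⟨t₁, h₁, p₁⟩ := e.runs_compile d hb.1 i hi t hs
    have a₁ := p₁.agree hi hs
    obtain ⟨t₂, h₂, p₂⟩ := f.runs_compile d hb.2 (i + 1) (by omega) t₁ a₁
    obtain ⟨t₃, v, h₃, p₃, hv, hv'⟩ := Runs.truth_value (d := d) (.eq i (i + 1)) i t₂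
    refine ⟨t₃, v, h₁.seq (h₂.seq h₃), p₁.trans (p₂.trans p₃ (by omega)) le_rfl, hv, ?_⟩
    simp [hv', Test.Holds, Cond.Holds, p₂.2.1, p₂.2.2 i (by omega), p₁.2.1]
  | distLe e f g h =>
    simp only [Cond.ok, Bool.and_eq_true] at hb
    obtain ⟨t₁, h₁, p₁⟩ := e.runs_compile d hb.1.1 i hi t hs
    have a₁ := p₁.agree hi hs
    obtain ⟨t₂, h₂, p₂⟩ := f.runs_compile d hb.1.2 (i + 1) (by omega) t₁ a₁
    have a₂ := p₂.agree (by omega) a₁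
    obtain ⟨t₃, h₃, p₃⟩ := g.runs_compile d hb.2.1 (i + 2) (by omega) t₂ a₂
    have a₃ := p₃.agree (by omega) a₂
    obtain ⟨t₄, h₄, p₄⟩ := h.runs_compile d hb.2.2 (i + 3) (by omega) t₃ a₃
    obtain ⟨t₅, v, h₅, p₅, hv, hv'⟩ :=
      Runs.truth_value (d := d) (.distLe i (i + 1) (i + 2) (i + 3)) i t₄
    refine ⟨t₅, v, h₁.seq (h₂.seq (h₃.seq (h₄.seq h₅))),
      p₁.trans (p₂.trans (p₃.trans (p₄.trans p₅ (by omega)) (by omega)) (by omega)) le_rfl, hv, ?_⟩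
    simp [hv', Test.Holds, Cond.Holds, p₄.2.1, p₄.2.2 i (by omega), p₄.2.2 (i + 1) (by omega),
      p₄.2.2 (i + 2) (by omega), p₃.2.1, p₃.2.2 i (by omega), p₃.2.2 (i + 1) (by omega), p₂.2.1,
      p₂.2.2 i (by omega), p₁.2.1]
  | and b c ihb ihc =>
    simp only [Cond.ok, Bool.and_eq_true] at hb
    obtain ⟨t₁, v, h₁, p₁, hv, hv'⟩ := ihb hb.1 i hi t hs
    obtain ⟨t₂, w, h₂, p₂, hw, hw'⟩ := ihc hb.2 (i + 1) (by omega) t₁ (p₁.agree hi hs)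
    refine ⟨_, v + w - 1, h₁.seq (h₂.seq ((Runs.const _ _ _).seq
      ((Runs.add _ _ _ _).seq (Runs.sub _ _ _ _)))), ⟨?_, ?_, fun y hy => ?_⟩, by omega, ?_⟩
    · simp [p₂.1, p₁.1]
    · simp [p₂.2.1, p₂.2.2 i (by omega), p₁.2.1]
    · simp [hy.ne, show y ≠ i + 2 by omega, p₂.2.2 y (by omega), p₁.2.2 y hy]
    · rw [Cond.Holds, ← hv', ← hw']; omega
  | not b ih =>
    obtain ⟨t₁, v, h₁, p₁, hv, hv'⟩ := ih hb i hi t hs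
    refine ⟨_, 1 - v, h₁.seq ((Runs.const _ _ _).seq (Runs.sub _ _ _ _)),
      ⟨?_, ?_, fun y hy => ?_⟩, by omega, ?_⟩
    · simp [p₁.1]
    · simp [p₁.2.1]
    · simp [hy.ne, show y ≠ i + 1 by omega, p₁.2.2 y hy]
    · rw [Cond.Holds, ← hv']; omega

lemma Agree.setReg {s t : State} (h : Agree s t) (x v : ℕ) :
    Agree (s.setReg x v) (t.setReg x v) :=
  ⟨h.1, fun y hy => by simp [h.2 y hy]⟩

lemma iter_reg {f : ℕ → State → State} {y : ℕ} (h : ∀ i t, (f i t).reg y = t.reg y) (k : ℕ)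
    (s : State) : (iter f k s).reg y = s.reg y := by
  induction k with
  | zero => rfl
  | succ k ih => rw [iter, h, ih]

lemma iter_arr {f : ℕ → State → State} {a : ℕ} (h : ∀ i t, (f i t).arr a = t.arr a) (k : ℕ)
    (s : State) : (iter f k s).arr a = s.arr a := by
  induction k with
  | zero => rfl
  | succ k ih => rw [iter, h, ih]

namespace Cmd

/-- A command does not change the registers that it does not mention as targets. -/
lemma eval_reg {d : ℕ → ℕ → ℝ} {y : ℕ} (c : Cmd) (hy : y ∉ c.regs) (s : State) :
    (c.eval d s).reg y = s.reg y := by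
  induction c generalizing s with
  | skip => rfl
  | set x e => simp [Cmd.regs] at hy; simp [Cmd.eval, hy]
  | store a i e => rfl
  | seq c c' ih ih' =>
    simp only [Cmd.regs, List.mem_append, not_or] at hy
    rw [Cmd.eval, ih' hy.2, ih hy.1]
  | ite b c c' ih ih' =>
    simp only [Cmd.regs, List.mem_append, not_or] at hy
    rw [Cmd.eval]; split_ifs
    · exact ih hy.1 s
    · exact ih' hy.2 s
  | loop x c ih =>
    simp only [Cmd.regs, List.mem_cons, not_or] at hy
    rw [Cmd.eval, State.setReg_reg, if_neg hy.1]
    exact iter_reg (fun i t => by rw [ih hy.2]; simp [hy.1]) _ _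

/-- A command does not change the arrays that it does not mention as targets. -/
lemma eval_arr {d : ℕ → ℕ → ℝ} {a : ℕ} (c : Cmd) (ha : a ∉ c.arrs) (s : State) :
    (c.eval d s).arr a = s.arr a := by
  induction c generalizing s with
  | skip => rfl
  | set x e => rfl
  | store b i e => simp [Cmd.arrs] at ha; simp [Cmd.eval, State.setArr_arr, ha]
  | seq c c' ih ih' =>
    simp only [Cmd.arrs, List.mem_append, not_or] at ha
    rw [Cmd.eval, ih' ha.2, ih ha.1]
  | ite b c c' ih ih' =>
    simp only [Cmd.arrs, List.mem_append, not_or] at ha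
    rw [Cmd.eval]; split_ifs
    · exact ih ha.1 s
    · exact ih' ha.2 s
  | loop x c ih =>
    rw [Cmd.eval, State.setReg_arr]
    exact iter_arr (fun i t => by rw [ih ha]; simp) _ _

lemma zero_notMem_regs (c : Cmd) (hc : c.ok) : 0 ∉ c.regs := by
  induction c with
  | skip => simp [Cmd.regs]
  | set x e => simp [Cmd.ok, Cmd.regs] at hc ⊢; omega
  | store a i e => simp [Cmd.regs]
  | seq c c' ih ih' => simp [Cmd.ok, Cmd.regs] at hc ⊢; exact ⟨ih hc.1, ih' hc.2⟩
  | ite b c c' ih ih' => simp [Cmd.ok, Cmd.regs] at hc ⊢; exact ⟨ih hc.2.1, ih' hc.2.2⟩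
  | loop x c ih => simp [Cmd.ok, Cmd.regs] at hc ⊢; exact ⟨by omega, ih hc.1⟩

/-- The program of a well-formed command computes its effect within its cost. -/
theorem runs_compile (d : ℕ → ℕ → ℝ) (c : Cmd) (hc : c.ok) (s t : State) (hs : Agree s t) :
    ∃ k t', Runs d c.compile t k t' ∧ k ≤ c.cost.eval (s.reg 0) ∧ Agree (c.eval d s) t' := by
  induction c generalizing s t with
  | skip => exact ⟨1, t, Runs.skip _, by simp [Cmd.cost], hs⟩
  | set x e =>
    simp only [Cmd.ok, Bool.and_eq_true, decide_eq_true_eq] at hc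
    obtain ⟨t', h, p⟩ := e.runs_compile d hc.1 100 le_rfl t hs
    refine ⟨_, _, h.seq (Runs.copy _ _ _), by simp [Cmd.cost], ?_⟩
    rw [p.2.1]
    exact (p.agree le_rfl hs).setReg _ _
  | store a i e =>
    simp only [Cmd.ok, Bool.and_eq_true] at hc
    obtain ⟨t', h, p⟩ := i.runs_compile d hc.1 100 le_rfl t hs
    have a₁ := p.agree le_rfl hs
    obtain ⟨t'', h', p'⟩ := e.runs_compile d hc.2 101 (by omega) t' a₁
    have a₂ := p'.agree (by omega) a₁
    refine ⟨_, _, h.seq (h'.seq (Runs.store _ _ _ _)), by simp [Cmd.cost], ?_⟩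
    rw [p'.2.1, p'.2.2 100 (by omega), p.2.1]
    exact ⟨by simp [State.setArr, Cmd.eval, a₂.1], a₂.2⟩
  | seq c c' ih ih' =>
    simp only [Cmd.ok, Bool.and_eq_true] at hc
    obtain ⟨k, t', h, hk, a⟩ := ih hc.1 s t hs
    obtain ⟨k', t'', h', hk', a'⟩ := ih' hc.2 _ t' a
    rw [eval_reg c (c.zero_notMem_regs hc.1)] at hk'
    exact ⟨_, _, h.seq h', by simp only [Cmd.cost, Polynomial.eval_add]; omega, a'⟩
  | ite b c c' ih ih' =>
    simp only [Cmd.ok, Bool.and_eq_true] at hc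
    obtain ⟨t', v, h, p, hv, hv'⟩ := b.runs_compile d hc.1 100 le_rfl t hs
    have hr : Runs d (.const 101 0) t' 1 (t'.setReg 101 0) := Runs.const _ _ _
    have a₁ : Agree s (t'.setReg 101 0) :=
      ⟨(p.agree le_rfl hs).1, fun x hx => by
        simp [show x ≠ 101 by omega, (p.agree le_rfl hs).2 x hx]⟩
    have ht : (Test.lt 101 100).Holds d (t'.setReg 101 0) ↔ b.Holds d s := by
      simp only [Test.Holds, State.setReg_reg, ← hv', p.2.1]; simp; omega
    rw [Cmd.eval]
    split_ifs with hb
    · obtain ⟨k, t'', h', hk, a⟩ := ih hc.2.1 s _ a₁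
      exact ⟨_, _, h.seq (hr.seq (Runs.ite_true (ht.2 hb) h')), by
        simp only [Cmd.cost, Polynomial.eval_add, Polynomial.eval_C]; omega, a⟩
    · obtain ⟨k, t'', h', hk, a⟩ := ih' hc.2.2 s _ a₁
      exact ⟨_, _, h.seq (hr.seq (Runs.ite_false (fun h => hb (ht.1 h)) h')), by
        simp only [Cmd.cost, Polynomial.eval_add, Polynomial.eval_C]; omega, a⟩
  | loop x c ih =>
    simp only [Cmd.ok, Bool.and_eq_true, decide_eq_true_eq] at hc
    obtain ⟨hc, hx0, hx, hxc⟩ := hc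
    set n := s.reg 0 with hn
    set f : ℕ → State → State := fun i t => c.eval d (t.setReg x i) with hf
    have h0 : ∀ i t, (f i t).reg 0 = t.reg 0 := fun i t => by
      rw [hf]; simp only; rw [eval_reg c (c.zero_notMem_regs hc)]; simp [hx0.ne]
    have hI0 : ∀ i, (iter f i s).reg 0 = n := fun i => iter_reg h0 i s
    -- Induction on the number `j` of remaining rounds. Beyond the body, a round costs 3 steps (the
    -- test, loading the constant 1, the increment); the summand 1 is the final failing test.
    have key : ∀ j i, i + j = n → ∀ t, Agree ((iter f i s).setReg x i) t →
        ∃ k t', Runs d (.while (.lt x 0) (.seq c.compile (.seq (.const 100 1) (.add x x 100))))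
          t k t' ∧ k ≤ 1 + j * (c.cost.eval n + 3) ∧ Agree ((iter f n s).setReg x n) t' := by
      intro j
      induction j with
      | zero =>
        intro i hi t a
        obtain rfl : i = n := by omega
        refine ⟨1, t, Runs.while_false ?_, by simp, a⟩
        have := a.2 x hx
        have := a.2 0 (by omega)
        simp [hx0.ne, hI0] at *
        simp [Test.Holds]; omega
      | succ j ihj =>
        intro i hi t a
        obtain ⟨k, t₁, h₁, hk, a₁⟩ := ih hc _ t a
        have e0 : ((iter f i s).setReg x i).reg 0 = n := by simp [hx0.ne, hI0]
        have hxi : t₁.reg x = i := by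
          rw [a₁.2 x hx, eval_reg c hxc]; simp
        rw [e0] at hk
        have a₂ : Agree ((iter f (i + 1) s).setReg x (i + 1))
            ((t₁.setReg 100 1).setReg x ((t₁.setReg 100 1).reg x + (t₁.setReg 100 1).reg 100)) := by
          refine ⟨a₁.1, fun y hy => ?_⟩
          have := a₁.2 y hy
          simp only [State.setReg_reg]
          split_ifs with h1 h2 h3 <;> first | omega | skip
          exact this
        obtain ⟨k', t', h', hk', a'⟩ := ihj (i + 1) (by omega) _ a₂
        refine ⟨_, _, Runs.while_true ?_
          (h₁.seq ((Runs.const _ _ _).seq (Runs.add _ _ _ _))) h', ?_, a'⟩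
        · have e1 := a.2 x hx
          have e2 := a.2 0 (by omega)
          simp [hx0.ne, hI0] at e1 e2
          simp [Test.Holds]; omega
        · rw [Nat.succ_mul]; omega
    obtain ⟨k, t', h, hk, a⟩ := key n 0 (by omega) (t.setReg x 0) (hs.setReg x 0)
    refine ⟨_, _, (Runs.const _ _ _).seq h, ?_, a⟩
    simp only [Cmd.cost, Polynomial.eval_add, Polynomial.eval_mul, Polynomial.eval_X,
      Polynomial.eval_ofNat]
    omega

/-! ### Reasoning about loops -/

/-- The invariant rule for loops. -/
lemma eval_loop {d : ℕ → ℕ → ℝ} {x : ℕ} {c : Cmd} {s : State} (I : ℕ → State → Prop)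
    (hI : ∀ i t v, I i t → I i (t.setReg x v)) (h0 : I 0 s)
    (hstep : ∀ i < s.reg 0, ∀ t, t.reg x = i → (∀ y ∉ (loop x c).regs, t.reg y = s.reg y) →
      (∀ a ∉ (loop x c).arrs, t.arr a = s.arr a) → I i t → I (i + 1) (c.eval d t)) :
    I (s.reg 0) ((loop x c).eval d s) := by
  rw [eval]
  apply hI
  have key : ∀ i ≤ s.reg 0,
      let t := iter (fun i t => c.eval d (t.setReg x i)) i s
      I i t ∧ (∀ y ∉ (loop x c).regs, t.reg y = s.reg y) ∧
        (∀ a ∉ (loop x c).arrs, t.arr a = s.arr a) := by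
    intro i hi
    induction i with
    | zero => exact ⟨h0, fun _ _ => rfl, fun _ _ => rfl⟩
    | succ i ih =>
      obtain ⟨h1, h2, h3⟩ := ih (by omega)
      have h2' : ∀ y ∉ (loop x c).regs, ((iter (fun i t => c.eval d (t.setReg x i)) i s).setReg
          x i).reg y = s.reg y := fun y hy => by
        have : y ≠ x := fun h => hy (by simp [regs, h])
        simp [this, h2 y hy]
      refine ⟨hstep i (by omega) _ (by simp) h2' h3 (hI _ _ _ h1), fun y hy => ?_, fun a ha => ?_⟩
      · rw [iter, eval_reg c (fun h => hy (by simp [regs, h])), h2' y hy]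
      · rw [iter, eval_arr c ha]; exact h3 a ha
  exact (key _ le_rfl).1

/-- Search for a value of `v` with the property `b`, to be stored in the register `x`. -/
def find (x v : ℕ) (b : Cond) : Cmd := loop v (ite b (set x (.var v)) skip)

/-- After an unsuccessful search `x` keeps its old content, which thereby serves as a default: the
sentinel `n`, or a point that remains a valid answer. -/
lemma eval_find {d : ℕ → ℕ → ℝ} {x v : ℕ} {b : Cond} {s : State} (hxv : x ≠ v)
    (p : ℕ → Prop)
    (hb : ∀ t, (∀ y, y ≠ x → y ≠ v → t.reg y = s.reg y) → t.arr = s.arr →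
      (b.Holds d t ↔ p (t.reg v))) :
    (((find x v b).eval d s).reg x < s.reg 0 ∧ p (((find x v b).eval d s).reg x)) ∨
      (((find x v b).eval d s).reg x = s.reg x ∧ ∀ i < s.reg 0, ¬ p i) := by
  refine eval_loop (I := fun k t => (t.reg x < s.reg 0 ∧ p (t.reg x)) ∨
    (t.reg x = s.reg x ∧ ∀ i < k, ¬ p i)) ?_ (by simp) ?_
  · intro i t w h; simpa [hxv] using h
  · intro i hi t hti hr ha ih
    have hbt := hb t (fun y h1 h2 => hr y (by simp [regs, h1, h2]))
      (funext fun a => ha a (by simp [arrs]))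
    rw [hti] at hbt
    rw [eval]
    split_ifs with h
    · left
      simp only [eval, State.setReg_reg, Expr.eval, if_true]
      rw [hti]; exact ⟨hi, hbt.1 h⟩
    · rcases ih with ih | ih
      · exact Or.inl ih
      · refine Or.inr ⟨ih.1, fun j hj => ?_⟩
        rcases Nat.lt_succ_iff_lt_or_eq.1 hj with hj | rfl
        · exact ih.2 j hj
        · rwa [← hbt]

/-- Set the first `n` cells of the array `a` to the values of `e`. -/
def fill (a v : ℕ) (e : Expr) : Cmd := loop v (store a (.var v) e)

lemma eval_fill {d : ℕ → ℕ → ℝ} {a v : ℕ} {e : Expr} {s : State} (f : ℕ → ℕ)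
    (he : ∀ t, (∀ y, y ≠ v → t.reg y = s.reg y) → (∀ b, b ≠ a → t.arr b = s.arr b) →
      e.eval t = f (t.reg v)) :
    ∀ i < s.reg 0, ((fill a v e).eval d s).arr a i = f i := by
  refine eval_loop (I := fun k t => ∀ i < k, t.arr a i = f i) ?_ (by simp) ?_
  · intro i t w h; simpa using h
  · intro i hi t hti hr ha ih j hj
    have := he t (fun y h => hr y (by simp [regs, h])) (fun b h => ha b (by simp [arrs, h]))
    simp only [eval, State.setArr_arr_apply, Expr.eval, true_and, hti, this]
    split_ifs with h
    · rw [h]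
    · exact ih j (by omega)

end Cmd

end RAM

/-! ### Growing a tree by nearest points -/

/-- Every point is in the same cluster as a point of `S`. -/
def Covers (n : ℕ) (cl : ℕ → ℕ) (S : Set ℕ) : Prop := ∀ u < n, ∃ v ∈ S, cl v = cl u

/-- Every subset of `E` that contains `r` and does not touch all clusters can be left, within `E`,
by an edge of length at most `lam`. -/
def CutBound (d : ℕ → ℕ → ℝ) (n : ℕ) (cl : ℕ → ℕ) (E : Set ℕ) (r : ℕ) (lam : ℝ) : Prop :=
  0 ≤ lam ∧ ∀ S ⊆ E, r ∈ S → ¬ Covers n cl S → ∃ u ∈ S, ∃ v ∈ E, v ∉ S ∧ d u v ≤ lam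

/-- The first `k` values of `o` are distinct points of `E`, starting with `r`, and the pairs
`(a e, b e)` connect each of them but the first one to an earlier one by an edge of length at most
`lam`. -/
structure Grown (d : ℕ → ℕ → ℝ) (E : Set ℕ) (r : ℕ) (o a b : ℕ → ℕ) (k : ℕ) (lam : ℝ) : Prop where
  pos : 0 < k
  first : o 0 = r
  mem : ∀ i < k, o i ∈ E
  inj : ∀ i < k, ∀ j < k, o i = o j → i = j
  snd : ∀ e, e + 1 < k → b e = o (e + 1)
  fst : ∀ e, e + 1 < k → ∃ j ≤ e, a e = o j
  le : ∀ e, e + 1 < k → d (a e) (b e) ≤ lam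

/-- The set of the first `k` values of `o`. -/
def firstValues (o : ℕ → ℕ) (k : ℕ) : Set ℕ := {v | ∃ i < k, o i = v}

/-- If no edge of length at most `lam` left `S`, then, in order of insertion, every tree vertex
would be drawn into `S` by the edge to its parent, and `S` would touch all clusters. -/
lemma Grown.cutBound {d : ℕ → ℕ → ℝ} {n : ℕ} {cl : ℕ → ℕ} {E : Set ℕ} {r : ℕ} {o a b : ℕ → ℕ}
    {k : ℕ} {lam : ℝ} (h : Grown d E r o a b k lam) (hc : Covers n cl (firstValues o k))
    (h0 : 0 ≤ lam) : CutBound d n cl E r lam := by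
  refine ⟨h0, fun S _ hr hS => ?_⟩
  by_contra! hno
  refine hS fun u hu => ?_
  obtain ⟨v, ⟨i, hi, rfl⟩, hv⟩ := hc u hu
  refine ⟨_, ?_, hv⟩
  clear hv
  induction i using Nat.strong_induction_on with
  | _ i ih =>
    rcases i with _ | e
    · rwa [h.first]
    · by_contra hS'
      obtain ⟨j, hj, hj'⟩ := h.fst e hi
      have := hno _ (ih j (by omega) (by omega)) _ (h.mem _ hi) hS'
      rw [← hj', ← h.snd e hi] at this
      exact absurd (h.le e hi) (not_le.2 this)

/-! ### Nearest-point growth as a command, and its optimality. -/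

namespace RAM

open Cmd

/-! Registers: `2` the root of the tree, `3` the number of its vertices, `4` and `5` the endpoints
of the shortest edge that leaves the tree, `6` a flag, `7` and `8` the endpoints of the longest
edge of the tree, `9`, `10`, `11` loop variables, `12` and `13` search results. Arrays: `0` the
clusters, `1` the vertices of the tree in the order of their insertion, `2` and `3` the endpoints
of its edges, `4` the status of the points (`2` in the tree, `1` eligible). -/

/-- Set the register `13` to a point whose cluster is not touched by the tree, and to `n` if there
is none. -/
def searchUntouched : Cmd :=
  seq (set 13 (.var 0)) (loop 10 (seq (set 12 (.var 0)) (seq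
    (find 12 11 (.and (.eq (.arr 4 (.var 11)) (.lit 2))
      (.eq (.arr 0 (.var 11)) (.arr 0 (.var 10)))))
    (ite (.eq (.var 12) (.var 0)) (set 13 (.var 10)) skip))))

lemma searchUntouched_spec (d : ℕ → ℕ → ℝ) (s : State) :
    ((searchUntouched.eval d s).reg 13 = s.reg 0 ↔
      ∀ u < s.reg 0, ∃ v < s.reg 0, s.arr 4 v = 2 ∧ s.arr 0 v = s.arr 0 u) := by
  rw [searchUntouched, eval]
  set s₁ := (set 13 (.var 0)).eval d s with hs₁
  have h0 : s₁.reg 0 = s.reg 0 := rfl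
  rw [← h0]
  refine eval_loop (I := fun k t => t.reg 13 = s₁.reg 0 ↔
    ∀ u < k, ∃ v < s₁.reg 0, s.arr 4 v = 2 ∧ s.arr 0 v = s.arr 0 u) ?_ ?_ ?_
  · intro i t w h; simpa using h
  · simp [hs₁, eval, Expr.eval]
  · intro i hi t hti hr ha ih
    have ht0 : t.reg 0 = s₁.reg 0 := hr 0 (by decide)
    have ha' : t.arr = s.arr := funext fun a => ha a (by simp [arrs, find])
    rw [eval_seq, eval_seq]
    set t₁ := (set 12 (.var 0)).eval d t with ht₁
    have e12 : t₁.reg 12 = s₁.reg 0 := by simpa [ht₁, eval, Expr.eval] using ht0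
    have e10 : t₁.reg 10 = i := by simpa [ht₁, eval, Expr.eval] using hti
    have e0 : t₁.reg 0 = s₁.reg 0 := by simpa [ht₁, eval, Expr.eval] using ht0
    have e13 : t₁.reg 13 = t.reg 13 := by simp [ht₁, eval, Expr.eval]
    have hfind := eval_find (d := d) (x := 12) (v := 11) (s := t₁)
      (b := (.and (.eq (.arr 4 (.var 11)) (.lit 2)) (.eq (.arr 0 (.var 11)) (.arr 0 (.var 10)))))
      (by decide) (fun v => s.arr 4 v = 2 ∧ s.arr 0 v = s.arr 0 i) (by
        intro t' hr' ha''
        have : t'.arr = s.arr := ha''.trans ha'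
        simp [Cond.Holds, Expr.eval, this, hr' 10 (by decide) (by decide), e10])
    have f0 := eval_reg (d := d) (y := 0) (find 12 11
      (.and (.eq (.arr 4 (.var 11)) (.lit 2)) (.eq (.arr 0 (.var 11)) (.arr 0 (.var 10)))))
      (by decide) t₁
    have f10 := eval_reg (d := d) (y := 10) (find 12 11
      (.and (.eq (.arr 4 (.var 11)) (.lit 2)) (.eq (.arr 0 (.var 11)) (.arr 0 (.var 10)))))
      (by decide) t₁
    have f13 := eval_reg (d := d) (y := 13) (find 12 11
      (.and (.eq (.arr 4 (.var 11)) (.lit 2)) (.eq (.arr 0 (.var 11)) (.arr 0 (.var 10)))))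
      (by decide) t₁
    set t₂ := (find 12 11
      (.and (.eq (.arr 4 (.var 11)) (.lit 2)) (.eq (.arr 0 (.var 11)) (.arr 0 (.var 10))))).eval d t₁
    rw [e0] at hfind f0
    rw [e12] at hfind
    rw [e10] at f10
    rw [eval]
    split_ifs with hb
    · have hb' : t₂.reg 12 = s₁.reg 0 := by simpa [Cond.Holds, Expr.eval, f0] using hb
      simp only [eval, State.setReg_reg, Expr.eval, if_true, f10]
      constructor
      · intro h; omega
      · intro h
        obtain ⟨v, hv, hv'⟩ := h i (by omega)
        rcases hfind with h | h
        · omega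
        · exact absurd hv' (h.2 v hv)
    · have hb' : t₂.reg 12 ≠ s₁.reg 0 := by simpa [Cond.Holds, Expr.eval, f0] using hb
      rcases hfind with h | h
      · rw [eval, f13, e13, ih]
        constructor
        · intro hu u hui
          rcases Nat.lt_succ_iff_lt_or_eq.1 hui with hui | rfl
          · exact hu u hui
          · exact ⟨_, h⟩
        · intro hu u hui
          exact hu u (by omega)
      · exact absurd h.1 hb'

/-- A search for the shortest edge from the tree to an eligible point. -/
def searchEdge : Cmd :=
  seq (set 6 (.lit 0)) (loop 10 (loop 11 (ite
    (.and (.and (.eq (.arr 4 (.var 10)) (.lit 2)) (.eq (.arr 4 (.var 11)) (.lit 1)))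
      (.not (.and (.eq (.var 6) (.lit 1)) (.distLe (.var 4) (.var 5) (.var 10) (.var 11)))))
    (seq (set 4 (.var 10)) (seq (set 5 (.var 11)) (set 6 (.lit 1)))) skip)))

/-- The state of the search for a shortest edge, where the pairs with the property `p` have been
searched. -/
def EdgeSearch (d : ℕ → ℕ → ℝ) (n : ℕ) (st : ℕ → ℕ) (p : ℕ → ℕ → Prop) (t : State) : Prop :=
  (t.reg 6 = 1 → t.reg 4 < n ∧ t.reg 5 < n ∧ st (t.reg 4) = 2 ∧ st (t.reg 5) = 1) ∧
  ∀ u < n, ∀ v < n, st u = 2 → st v = 1 → p u v →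
    t.reg 6 = 1 ∧ d (t.reg 4) (t.reg 5) ≤ d u v

lemma EdgeSearch.mono {d : ℕ → ℕ → ℝ} {n : ℕ} {st : ℕ → ℕ} {p q : ℕ → ℕ → Prop} {t : State}
    (h : EdgeSearch d n st p t) (hpq : ∀ u < n, ∀ v < n, q u v → p u v) :
    EdgeSearch d n st q t :=
  ⟨h.1, fun u hu v hv h1 h2 h3 => h.2 u hu v hv h1 h2 (hpq u hu v hv h3)⟩

lemma EdgeSearch.setReg {d : ℕ → ℕ → ℝ} {n : ℕ} {st : ℕ → ℕ} {p : ℕ → ℕ → Prop} {t : State}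
    (h : EdgeSearch d n st p t) (x w : ℕ) (hx : 6 < x) : EdgeSearch d n st p (t.setReg x w) := by
  simpa [EdgeSearch, hx.ne, show 4 ≠ x by omega, show 5 ≠ x by omega] using h

lemma searchEdge_spec (d : ℕ → ℕ → ℝ) (s : State)
    (hs : ∃ u < s.reg 0, ∃ v < s.reg 0, s.arr 4 u = 2 ∧ s.arr 4 v = 1) :
    let t := searchEdge.eval d s
    t.reg 4 < s.reg 0 ∧ t.reg 5 < s.reg 0 ∧ s.arr 4 (t.reg 4) = 2 ∧ s.arr 4 (t.reg 5) = 1 ∧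
      ∀ u < s.reg 0, ∀ v < s.reg 0, s.arr 4 u = 2 → s.arr 4 v = 1 →
        d (t.reg 4) (t.reg 5) ≤ d u v := by
  intro t
  suffices h : EdgeSearch d (s.reg 0) (s.arr 4) (fun u _ => u < s.reg 0) t by
    obtain ⟨u, hu, v, hv, h1, h2⟩ := hs
    obtain ⟨a, b, c, e⟩ := h.1 (h.2 u hu v hv h1 h2 hu).1
    exact ⟨a, b, c, e, fun u hu v hv h1 h2 => (h.2 u hu v hv h1 h2 hu).2⟩
  simp only [t]
  rw [searchEdge, eval]
  set s₁ := (set 6 (.lit 0)).eval d s with hs₁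
  have h0 : s₁.reg 0 = s.reg 0 := rfl
  rw [← h0]
  refine eval_loop (I := fun k t => EdgeSearch d (s₁.reg 0) (s.arr 4) (fun u _ => u < k) t) ?_ ?_ ?_
  · intro i t w h; exact h.setReg 10 w (by decide)
  · refine ⟨?_, by simp⟩
    simp [hs₁, eval, Expr.eval]
  · intro i hi t hti hr ha ih
    have ht0 : t.reg 0 = s₁.reg 0 := hr 0 (by decide)
    have ha' : t.arr = s.arr := funext fun a => ha a (by simp [arrs])
    -- Pairs are searched lexicographically; a completed row `i` amounts to all rows below `i + 1`.
    refine EdgeSearch.mono (p := fun u v => u < i ∨ u = i ∧ v < s₁.reg 0) ?_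
      (fun u hu v hv h => by omega)
    rw [← ht0]
    refine eval_loop (I := fun k t' => EdgeSearch d (t.reg 0) (s.arr 4)
      (fun u v => u < i ∨ u = i ∧ v < k) t') ?_ ?_ ?_
    · intro j t' w h; exact h.setReg 11 w (by decide)
    · rw [ht0]; exact ih.mono (fun u hu v hv h => by omega)
    · intro j hj t' htj hr' ha'' ih'
      have ha₃ : t'.arr = s.arr := (funext fun a => ha'' a (by simp [arrs])).trans ha'
      have ht10 : t'.reg 10 = i := (hr' 10 (by decide)).trans hti
      rw [ht0] at hj
      rw [ht0] at ih'
      rw [ht0, eval]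
      split_ifs with hb
      · simp only [Cond.Holds, Expr.eval, ha₃, ht10, htj] at hb
        simp only [eval, Expr.eval, EdgeSearch, State.setReg_reg]
        simp only [ht10, htj, Nat.reduceEqDiff, if_true, if_false, true_and]
        refine ⟨fun _ => ⟨hi, hj, hb.1.1, hb.1.2⟩, fun u hu v hv h1 h2 h3 => ?_⟩
        by_cases h : u = i ∧ v = j
        · rw [h.1, h.2]
        · obtain ⟨h4, h5⟩ := ih'.2 u hu v hv h1 h2 (by omega)
          have := hb.2
          simp only [h4, true_and, not_le] at this
          exact this.le.trans h5
      · simp only [Cond.Holds, Expr.eval, ha₃, ht10, htj] at hb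
        rw [eval]
        refine ⟨ih'.1, fun u hu v hv h1 h2 h3 => ?_⟩
        by_cases h : u = i ∧ v = j
        · obtain ⟨rfl, rfl⟩ := h
          by_contra h'
          exact hb ⟨⟨h1, h2⟩, h'⟩
        · exact ih'.2 u hu v hv h1 h2 (by omega)

/-- Insert the point in the register `5` into the tree. -/
def insertPoint : Cmd :=
  seq (store 4 (.var 5) (.lit 2)) (seq (store 1 (.var 3) (.var 5))
    (set 3 (.add (.var 3) (.lit 1))))

/-- Add the edge given by the registers `4` and `5` to the tree. -/
def insertEdge : Cmd :=
  seq (store 2 (.sub (.var 3) (.lit 1)) (.var 4)) (seq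
    (store 3 (.sub (.var 3) (.lit 1)) (.var 5)) (seq
    (ite (.distLe (.var 7) (.var 8) (.var 4) (.var 5))
      (seq (set 7 (.var 4)) (set 8 (.var 5))) skip) insertPoint))

/-- Grow a tree from the root by nearest eligible points until it touches all clusters. -/
def growTree : Cmd :=
  seq (set 3 (.lit 0)) (seq (set 5 (.var 2)) (seq (set 7 (.var 2)) (seq (set 8 (.var 2)) (seq
    insertPoint (loop 9 (seq searchUntouched
      (ite (.eq (.var 13) (.var 0)) skip (seq searchEdge insertEdge))))))))

/-- The invariant of the growing tree. -/
structure Growing (d : ℕ → ℕ → ℝ) (n : ℕ) (cl : ℕ → ℕ) (E : Set ℕ) (r : ℕ) (t : State) : Prop where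
  grown : Grown d E r (t.arr 1) (t.arr 2) (t.arr 3) (t.reg 3) (d (t.reg 7) (t.reg 8))
  status : ∀ v < n, t.arr 4 v = 2 ↔ v ∈ firstValues (t.arr 1) (t.reg 3)
  eligible : ∀ v < n, t.arr 4 v = 1 ↔ v ∈ E ∧ v ∉ firstValues (t.arr 1) (t.reg 3)
  le_of_cutBound : ∀ lam, CutBound d n cl E r lam → d (t.reg 7) (t.reg 8) ≤ lam
  nonneg : 0 ≤ d (t.reg 7) (t.reg 8)

lemma Growing.congr {d : ℕ → ℕ → ℝ} {n : ℕ} {cl : ℕ → ℕ} {E : Set ℕ} {r : ℕ} {t t' : State}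
    (h : Growing d n cl E r t) (h3 : t'.reg 3 = t.reg 3) (h7 : t'.reg 7 = t.reg 7)
    (h8 : t'.reg 8 = t.reg 8) (ha : t'.arr = t.arr) : Growing d n cl E r t' := by
  constructor
  · rw [ha, h3, h7, h8]; exact h.grown
  · rw [ha, h3]; exact h.status
  · rw [ha, h3]; exact h.eligible
  · rw [h7, h8]; exact h.le_of_cutBound
  · rw [h7, h8]; exact h.nonneg

lemma Growing.covers_iff {d : ℕ → ℕ → ℝ} {n : ℕ} {cl : ℕ → ℕ} {E : Set ℕ} {r : ℕ} {t : State}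
    (h : Growing d n cl E r t) (hE : ∀ v ∈ E, v < n) :
    Covers n cl (firstValues (t.arr 1) (t.reg 3)) ↔
      ∀ u < n, ∃ v < n, t.arr 4 v = 2 ∧ cl v = cl u := by
  refine forall₂_congr fun u hu => ⟨?_, ?_⟩
  · rintro ⟨v, hv, h'⟩
    have hvn : v < n := by
      obtain ⟨i, hi, rfl⟩ := hv
      exact hE _ (h.grown.mem i hi)
    exact ⟨v, hvn, (h.status v hvn).2 hv, h'⟩
  · rintro ⟨v, hv, h1, h2⟩
    exact ⟨v, (h.status v hv).1 h1, h2⟩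

lemma Growing.size_le {d : ℕ → ℕ → ℝ} {n : ℕ} {cl : ℕ → ℕ} {E : Set ℕ} {r : ℕ} {t : State}
    (h : Growing d n cl E r t) (hE : ∀ v ∈ E, v < n) : t.reg 3 ≤ n := by
  have := Finset.card_le_card_of_injOn (s := Finset.range (t.reg 3)) (t := Finset.range n)
    (t.arr 1) (fun i hi => by simpa using hE _ (h.grown.mem i (by simpa using hi)))
    (fun i hi j hj hij => h.grown.inj i (by simpa using hi) j (by simpa using hj) hij)
  simpa using this

lemma firstValues_succ (o : ℕ → ℕ) (k v w : ℕ) :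
    w ∈ firstValues (fun i => if i = k then v else o i) (k + 1) ↔ w = v ∨ w ∈ firstValues o k := by
  constructor
  · rintro ⟨i, hi, rfl⟩
    by_cases h : i = k
    · simp [h]
    · exact Or.inr ⟨i, by omega, by simp [h]⟩
  · rintro (rfl | ⟨i, hi, rfl⟩)
    · exact ⟨k, by omega, by simp⟩
    · exact ⟨i, by omega, by simp [hi.ne]⟩

/-- The cut argument of Prim's algorithm: the current vertex set contains the root and misses a
cluster, so any `CutBound` supplies an edge leaving it, and the shortest leaving edge is no longer
than that one. -/
lemma Growing.step {d : ℕ → ℕ → ℝ} {n : ℕ} {cl : ℕ → ℕ} {E : Set ℕ} {r : ℕ} {t : State}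
    (h : Growing d n cl E r t) (hE : ∀ v ∈ E, v < n) (hcE : Covers n cl E) (h0 : t.reg 0 = n)
    (hc : ¬ Covers n cl (firstValues (t.arr 1) (t.reg 3))) :
    let t' := insertEdge.eval d (searchEdge.eval d t)
    Growing d n cl E r t' ∧ t'.reg 3 = t.reg 3 + 1 := by
  intro t'
  have hpos := h.grown.pos
  have hmem : ∀ v ∈ firstValues (t.arr 1) (t.reg 3), v ∈ E := by
    rintro v ⟨i, hi, rfl⟩; exact h.grown.mem i hi
  have hr : r ∈ firstValues (t.arr 1) (t.reg 3) := ⟨0, hpos, h.grown.first⟩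
  have hex : ∃ v ∈ E, v ∉ firstValues (t.arr 1) (t.reg 3) := by
    by_contra! hno
    exact hc fun u hu => (hcE u hu).imp fun v hv => ⟨hno v hv.1, hv.2⟩
  obtain ⟨w, hwE, hw⟩ := hex
  have hspec := searchEdge_spec d t (by
    rw [h0]
    exact ⟨r, hE _ (hmem _ hr), w, hE _ hwE, (h.status _ (hE _ (hmem _ hr))).2 hr,
      (h.eligible _ (hE _ hwE)).2 ⟨hwE, hw⟩⟩)
  have e3 := eval_reg (d := d) (y := 3) searchEdge (by decide) t
  have e7 := eval_reg (d := d) (y := 7) searchEdge (by decide) t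
  have e8 := eval_reg (d := d) (y := 8) searchEdge (by decide) t
  have ea : (searchEdge.eval d t).arr = t.arr :=
    funext fun a => eval_arr _ (by simp [searchEdge, arrs]) t
  simp only [t']
  set s := searchEdge.eval d t
  obtain ⟨hu, hv, hus, hvs, hmin⟩ := hspec
  rw [h0] at hu hv hmin
  have hus' := (h.status _ hu).1 hus
  obtain ⟨hvE, hvs'⟩ := (h.eligible _ hv).1 hvs
  set u := s.reg 4 with hu4
  set v := s.reg 5 with hv5
  have hcut : ∀ lam, CutBound d n cl E r lam → d u v ≤ lam := by
    intro lam hl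
    obtain ⟨x, hx, y, hy, hy', hxy⟩ := hl.2 _ hmem hr hc
    exact (hmin x (hE _ (hmem _ hx)) y (hE _ hy) ((h.status _ (hE _ (hmem _ hx))).2 hx)
      ((h.eligible _ (hE _ hy)).2 ⟨hy, hy'⟩)).trans hxy
  set k := t.reg 3 with hk
  -- the components of the resulting state
  have key : (insertEdge.eval d s).reg 3 = k + 1 ∧
      ((insertEdge.eval d s).arr 1 = fun i => if i = k then v else t.arr 1 i) ∧
      ((insertEdge.eval d s).arr 2 = fun i => if i = k - 1 then u else t.arr 2 i) ∧
      ((insertEdge.eval d s).arr 3 = fun i => if i = k - 1 then v else t.arr 3 i) ∧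
      ((insertEdge.eval d s).arr 4 = fun i => if i = v then 2 else t.arr 4 i) ∧
      ((insertEdge.eval d s).reg 7 = u ∧ (insertEdge.eval d s).reg 8 = v ∧
      d (t.reg 7) (t.reg 8) ≤ d u v ∨
      (insertEdge.eval d s).reg 7 = t.reg 7 ∧ (insertEdge.eval d s).reg 8 = t.reg 8 ∧
      d u v ≤ d (t.reg 7) (t.reg 8)) := by
    by_cases hb : d (t.reg 7) (t.reg 8) ≤ d u v
    · simp [insertEdge, insertPoint, eval, Expr.eval, Cond.Holds, funext_iff, e3, e7, e8, ea,
        ← hu4, ← hv5, hb]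
    · simp [insertEdge, insertPoint, eval, Expr.eval, Cond.Holds, funext_iff, e3, e7, e8, ea,
        ← hu4, ← hv5, hb, (not_le.1 hb).le]
  obtain ⟨r3, a1, a2, a3, a4, r78⟩ := key
  have hmax : d (t.reg 7) (t.reg 8) ≤
      d ((insertEdge.eval d s).reg 7) ((insertEdge.eval d s).reg 8) ∧
      d u v ≤ d ((insertEdge.eval d s).reg 7) ((insertEdge.eval d s).reg 8) := by
    rcases r78 with ⟨h7, h8, hle⟩ | ⟨h7, h8, hle⟩ <;> rw [h7, h8]
    · exact ⟨hle, le_rfl⟩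
    · exact ⟨le_rfl, hle⟩
  have hvo : ∀ i < k, t.arr 1 i ≠ v := fun i hi h' => hvs' ⟨i, hi, h'⟩
  refine ⟨⟨⟨?_, ?_, ?_, ?_, ?_, ?_, ?_⟩, ?_, ?_, ?_, h.nonneg.trans hmax.1⟩, r3⟩
  · omega
  · rw [a1]; simp [hpos.ne, h.grown.first]
  · intro i hi
    rw [a1]; simp only
    split_ifs with hik
    · exact hvE
    · exact h.grown.mem i (by omega)
  · intro i hi j hj
    rw [a1]; simp only
    rw [r3] at hi hj
    split_ifs with h1 h2 h2
    · intro _; omega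
    · intro h'; exact absurd h'.symm (hvo j (by omega))
    · intro h'; exact absurd h' (hvo i (by omega))
    · exact h.grown.inj i (by omega) j (by omega)
  · intro e he
    rw [a1, a3]; simp only
    rw [r3] at he
    by_cases h1 : e = k - 1
    · rw [if_pos h1, if_pos (by omega)]
    · rw [if_neg h1, if_neg (by omega)]; exact h.grown.snd e (by omega)
  · intro e he
    rw [a1, a2]; simp only
    rw [r3] at he
    by_cases h1 : e = k - 1
    · obtain ⟨j, hj, hj'⟩ := hus'
      exact ⟨j, by omega, by rw [if_pos h1, if_neg hj.ne, hj']⟩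
    · obtain ⟨j, hj, hj'⟩ := h.grown.fst e (by omega)
      exact ⟨j, hj, by rw [if_neg h1, if_neg (by omega), hj']⟩
  · intro e he
    rw [a2, a3]; simp only
    rw [r3] at he
    split_ifs with h1
    · exact hmax.2
    · exact (h.grown.le e (by omega)).trans hmax.1
  · intro x hx
    rw [a1, a4, r3, firstValues_succ]; simp only
    by_cases hxv : x = v
    · simp [hxv]
    · simp only [hxv, if_false, false_or]; exact h.status x hx
  · intro x hx
    rw [a1, a4, r3, firstValues_succ]; simp only
    by_cases hxv : x = v
    · simp [hxv]
    · simp only [hxv, if_false, false_or]; exact h.eligible x hx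
  · intro lam hl
    rcases r78 with ⟨h7, h8, _⟩ | ⟨h7, h8, _⟩ <;> rw [h7, h8]
    · exact hcut lam hl
    · exact h.le_of_cutBound lam hl

open Classical in
/-- The procedure `growTree` yields a tree that touches all clusters, and whose longest edge is as
short as possible for its root. -/
theorem growTree_spec {d : ℕ → ℕ → ℝ} {n : ℕ} {cl : ℕ → ℕ} {E : Set ℕ} {r : ℕ} {s : State}
    (h0 : s.reg 0 = n) (h2 : s.reg 2 = r) (hcl : ∀ v < n, s.arr 0 v = cl v)
    (hst : ∀ v < n, s.arr 4 v = if v ∈ E then 1 else 0) (hE : ∀ v ∈ E, v < n)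
    (hcE : Covers n cl E) (hr : r ∈ E) (hd : d r r = 0) :
    let t := growTree.eval d s
    Growing d n cl E r t ∧ Covers n cl (firstValues (t.arr 1) (t.reg 3)) := by
  intro t
  simp only [t, growTree]
  simp only [eval_seq, eval_set, Expr.eval, State.setReg_reg, Nat.reduceEqDiff, if_false]
  set s₁ := insertPoint.eval d _ with hs₁
  have g1 : Growing d n cl E r s₁ ∧ s₁.reg 0 = n ∧ (∀ v < n, s₁.arr 0 v = cl v) ∧
      s₁.reg 3 = 1 := by
    have r3 : s₁.reg 3 = 1 := by simp [hs₁, insertPoint, eval, Expr.eval]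
    have r7 : s₁.reg 7 = r := by simp [hs₁, insertPoint, eval, Expr.eval, h2]
    have r8 : s₁.reg 8 = r := by simp [hs₁, insertPoint, eval, Expr.eval, h2]
    have a1 : s₁.arr 1 0 = r := by simp [hs₁, insertPoint, eval, Expr.eval, h2]
    have a4 : ∀ v, s₁.arr 4 v = if v = r then 2 else s.arr 4 v := by
      simp [hs₁, insertPoint, eval, Expr.eval, h2]
    have hfv : ∀ v, v ∈ firstValues (s₁.arr 1) 1 ↔ v = r := by
      intro v; simp [firstValues, a1, eq_comm]
    refine ⟨⟨⟨by omega, a1, ?_, ?_, ?_, ?_, ?_⟩, ?_, ?_, ?_, ?_⟩, ?_, ?_, r3⟩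
    · intro i hi; obtain rfl : i = 0 := by omega
      rwa [a1]
    · intro i hi j hj; omega
    · intro e he; omega
    · intro e he; omega
    · intro e he; omega
    · intro v hv
      rw [a4, r3, hfv]
      by_cases h : v = r <;> simp [h, hst v hv]
      split_ifs <;> simp
    · intro v hv
      rw [a4, r3, hfv]
      by_cases h : v = r <;> simp [h, hst v hv]
    -- A tree with one vertex has no edge; its bottleneck 0 is coded by the degenerate pair `(r,
    -- r)`.
    · intro lam hl; rw [r7, r8, hd]; exact hl.1
    · rw [r7, r8, hd]
    · simp [hs₁, insertPoint, eval, Expr.eval, h0]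
    · simpa [hs₁, insertPoint, eval, Expr.eval] using hcl
  obtain ⟨g1, h01, hcl1, h31⟩ := g1
  clear_value s₁
  have hmain : ∀ u : State, u = (loop 9 (seq searchUntouched
      (ite (.eq (.var 13) (.var 0)) skip (seq searchEdge insertEdge)))).eval d s₁ →
      Growing d n cl E r u ∧ (Covers n cl (firstValues (u.arr 1) (u.reg 3)) ∨
        s₁.reg 0 + 1 ≤ u.reg 3) := by
    rintro u rfl
    refine eval_loop (I := fun k t => Growing d n cl E r t ∧
      (Covers n cl (firstValues (t.arr 1) (t.reg 3)) ∨ k + 1 ≤ t.reg 3)) ?_ ?_ ?_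
    · intro i t w h
      exact ⟨h.1.congr (by simp) (by simp) (by simp) rfl, by simpa using h.2⟩
    · exact ⟨g1, Or.inr (by omega)⟩
    · rintro i hi t hti hreg harr ⟨hg, hor⟩
      rw [eval]
      have hspec := searchUntouched_spec d t
      have e0 := eval_reg (d := d) (y := 0) searchUntouched (by decide) t
      have e3 := eval_reg (d := d) (y := 3) searchUntouched (by decide) t
      have e7 := eval_reg (d := d) (y := 7) searchUntouched (by decide) t
      have e8 := eval_reg (d := d) (y := 8) searchUntouched (by decide) t
      have ea : (searchUntouched.eval d t).arr = t.arr :=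
        funext fun a => eval_arr _ (by simp [searchUntouched, find, arrs]) t
      set t₁ := searchUntouched.eval d t
      have ht0 : t.reg 0 = n := (hreg 0 (by decide)).trans h01
      have hcl' : ∀ v < n, t.arr 0 v = cl v := fun v hv => by
        rw [harr 0 (by decide)]; exact hcl1 v hv
      have hg₁ : Growing d n cl E r t₁ := hg.congr e3 e7 e8 ea
      have hiff : t₁.reg 13 = n ↔ Covers n cl (firstValues (t₁.arr 1) (t₁.reg 3)) := by
        rw [hg₁.covers_iff hE, ea, ← ht0, hspec, ht0]
        refine forall₂_congr fun u hu => exists_congr fun v => and_congr_right fun hv => ?_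
        rw [hcl' u hu, hcl' v hv]
      rw [eval]
      split_ifs with hb
      · simp only [Cond.Holds, Expr.eval, e0, ht0] at hb
        exact ⟨hg₁, Or.inl (hiff.1 hb)⟩
      · simp only [Cond.Holds, Expr.eval, e0, ht0] at hb
        rw [hiff] at hb
        obtain ⟨hg', hk⟩ := hg₁.step hE hcE (e0.trans ht0) hb
        rw [eval]
        refine ⟨hg', Or.inr ?_⟩
        rw [hk, e3]
        rw [ea, e3] at hb
        have := hor.resolve_left hb
        omega
  obtain ⟨hg, hor⟩ := hmain _ rfl
  -- A round that finds an untouched cluster adds a new point, so `n` such rounds would produce `n +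
  -- 1` distinct points below `n`.
  refine ⟨hg, hor.resolve_right fun h => ?_⟩
  have := hg.size_le hE
  omega

end RAM

/-! ### Matching and selecting points -/

/-- An involution of the points, given by a matching of points of a tree by edges of length at
most `lam`, in which every point that has a child is matched. -/
structure TreeMatching (d : ℕ → ℕ → ℝ) (n : ℕ) (o a : ℕ → ℕ) (k : ℕ) (lam : ℝ) (μ : ℕ → ℕ) :
    Prop where
  lt : ∀ v < n, μ v < n
  invol : ∀ v < n, μ (μ v) = v
  le : ∀ v < n, μ v ≠ v → d v (μ v) ≤ lam
  mem : ∀ v < n, μ v ≠ v → v ∈ firstValues o k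
  inner : ∀ e, e + 1 < k → μ (a e) ≠ a e

/-- A set of points of a tree which touches all clusters and hits all edges of a matching that
covers all inner vertices is connected by edges of three times the length. -/
lemma TreeMatching.cutBound {d : ℕ → ℕ → ℝ} {n : ℕ} {cl : ℕ → ℕ} {E : Set ℕ} {r : ℕ}
    {o a b : ℕ → ℕ} {k : ℕ} {lam : ℝ} {μ : ℕ → ℕ} (hμ : TreeMatching d n o a k lam μ)
    (hg : Grown d E r o a b k lam) (hE : ∀ v ∈ E, v < n) (h0 : 0 ≤ lam)
    (hself : ∀ u < n, d u u = 0) (hsymm : ∀ u v, d u v = d v u)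
    (htri : ∀ u < n, ∀ v < n, ∀ w < n, d u w ≤ d u v + d v w) {C : Set ℕ}
    (hC : C ⊆ firstValues o k) (hcov : Covers n cl C)
    (hit : ∀ v < n, μ v ≠ v → v ∈ C ∨ μ v ∈ C) (r' : ℕ) :
    CutBound d n cl C r' (3 * lam) := by
  classical
  refine ⟨by positivity, fun A hA hr' hAc => ?_⟩
  by_contra! hno
  obtain ⟨c, hcC, hcA⟩ : ∃ c ∈ C, c ∉ A := by
    by_contra! h
    exact hAc fun u hu => (hcov u hu).imp fun v hv => ⟨h v hv.1, hv.2⟩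
  have hon : ∀ i < k, o i < n := fun i hi => hE _ (hg.mem i hi)
  -- The chosen point that stands for `v`; it is meaningful when `v` is chosen or matched.
  set rep : ℕ → ℕ := fun v => if v ∈ C then v else μ v with hrep
  have hrepC : ∀ v < n, (v ∈ C ∨ μ v ≠ v) → rep v ∈ C ∧ rep v < n ∧ d v (rep v) ≤ lam := by
    intro v hv h
    by_cases hvC : v ∈ C
    · simp only [hrep, hvC, if_true, hself v hv]
      exact ⟨trivial, hv, h0⟩
    · have hm := h.resolve_left hvC
      simp only [hrep, hvC, if_false]
      exact ⟨(hit v hv hm).resolve_left hvC, hμ.lt v hv, hμ.le v hv hm⟩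
  -- Membership in `A` spreads from parent to child, since their representatives are within `3 *
  -- lam` and no edge this short leaves `A`. Parents are always matched, so the induction never
  -- passes through a vertex without a representative.
  have claim : ∀ i < k, (o i ∈ C ∨ μ (o i) ≠ o i) → (rep (o i) ∈ A ↔ rep (o 0) ∈ A) := by
    intro i
    induction i using Nat.strong_induction_on with
    | _ i ih =>
      intro hi hact
      rcases i with _ | e
      · rfl
      · obtain ⟨j, hj, hj'⟩ := hg.fst e hi
        have hact' : o j ∈ C ∨ μ (o j) ≠ o j := Or.inr (hj' ▸ hμ.inner e hi)
        rw [← ih j (by omega) (by omega) hact']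
        obtain ⟨h1, h2, h3⟩ := hrepC _ (hon _ hi) hact
        obtain ⟨h4, h5, h6⟩ := hrepC _ (hon j (by omega)) hact'
        have hle := hg.le e hi
        rw [hj', hg.snd e hi] at hle
        have hd : d (rep (o j)) (rep (o (e + 1))) ≤ 3 * lam := by
          have t1 := htri _ h5 _ (hon j (by omega)) _ h2
          have t2 := htri _ (hon j (by omega)) _ (hon _ hi) _ h2
          rw [hsymm] at h6
          linarith
        constructor
        · intro h
          by_contra h'
          have := hno _ h _ h4 h'
          rw [hsymm] at this
          linarith
        · intro h
          by_contra h'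
          have := hno _ h _ h1 h'
          linarith
  have hfin : ∀ v ∈ C, (v ∈ A ↔ rep (o 0) ∈ A) := by
    intro v hv
    obtain ⟨i, hi, rfl⟩ := hC hv
    have := claim i hi (Or.inl hv)
    simpa [hrep, hv] using this
  exact hcA ((hfin c hcC).2 ((hfin r' (hA hr')).1 hr'))

/-- The state of a coloring of the points by `0` (undecided), `1` (chosen) and `2` (rejected),
where choosing an undecided point `x` may be due because the partner of `x` was rejected. -/
structure Coloring (n : ℕ) (cl : ℕ → ℕ) (S : Set ℕ) (μ c : ℕ → ℕ) (x : ℕ) : Prop where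
  lt : x < n
  le : ∀ v < n, c v ≤ 2
  out : ∀ v < n, v ∉ S → c v = 2
  one : ∀ v < n, ∀ w < n, c v = 1 → w ≠ v → cl w = cl v → c w = 2
  two : ∀ v < n, v ∈ S → c v = 2 → ∃ w < n, c w = 1 ∧ cl w = cl v
  mate : ∀ v < n, c v = 2 → μ v ≠ v → c (μ v) = 1 ∨ (μ v = x ∧ c x = 0)

/-- One move of the alternating walk: choosing `x` rejects its cluster mate `y`, which makes the
choice of `μ y` the only debt, while a debt at `x` is now paid. The case `y = x` is a cluster
without a second point. -/
lemma Coloring.step {d : ℕ → ℕ → ℝ} {n : ℕ} {cl : ℕ → ℕ} {o a : ℕ → ℕ} {k : ℕ} {lam : ℝ}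
    {μ c : ℕ → ℕ} {x y : ℕ} (h : Coloring n cl (firstValues o k) μ c x)
    (hμ : TreeMatching d n o a k lam μ) (hx : c x = 0) (hy : y < n) (hxy : cl y = cl x)
    (huniq : ∀ w < n, w ≠ x → cl w = cl x → w = y) :
    Coloring n cl (firstValues o k) μ (fun v => if v = x then 1 else if v = y then 2 else c v)
      (μ y) := by
  have hxn := h.lt
  have hxS : x ∈ firstValues o k := by
    by_contra hxS
    have := h.out x hxn hxS
    omega
  have hy1 : c y ≠ 1 := by
    intro h1
    by_cases hyx : y = x
    · rw [hyx] at h1; omega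
    · have := h.one y hy x hxn h1 (Ne.symm hyx) hxy.symm
      omega
  refine ⟨hμ.lt y hy, ?_, ?_, ?_, ?_, ?_⟩
  · intro v hv
    have := h.le v hv
    split_ifs <;> omega
  · intro v hv hvS
    have hvx : v ≠ x := fun h' => hvS (h' ▸ hxS)
    have := h.out v hv hvS
    simp [hvx, this]
  · intro v hv w hw hv1 hwv hcl
    split_ifs at hv1 with hvx hvy
    · subst hvx
      rw [if_neg hwv, if_pos (huniq w hw hwv hcl)]
    · omega
    · have hwx : w ≠ x := by
        rintro rfl
        have := h.one v hv w hw hv1 hwv hcl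
        omega
      have := h.one v hv w hw hv1 hwv hcl
      rw [if_neg hwx]; split_ifs
      · rfl
      · exact this
  · intro v hv hvS hv2
    split_ifs at hv2 with hvx hvy
    · omega
    · exact ⟨x, hxn, by simp, by rw [hvy, hxy]⟩
    · obtain ⟨w, hw, hw1, hwcl⟩ := h.two v hv hvS hv2
      refine ⟨w, hw, ?_, hwcl⟩
      have hwy : w ≠ y := fun h' => hy1 (h' ▸ hw1)
      simp [hw1, hwy]
  · intro v hv hv2 hvm
    split_ifs at hv2 with hvx hvy
    · omega
    · subst hvy
      by_cases h1 : μ v = x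
      · left; simp [h1]
      -- Had the partner been rejected earlier, `v` would already be chosen, or would be the due
      -- point `x` itself.
      · have h2 : c (μ v) ≠ 2 := by
          intro h2
          have hm : μ (μ v) ≠ μ v := by rw [hμ.invol v hv]; exact Ne.symm hvm
          have := h.mate _ (hμ.lt v hv) h2 hm
          rw [hμ.invol v hv] at this
          rcases this with h3 | h3
          · exact hy1 h3
          · exact hvx h3.1
        have h3 := h.le _ (hμ.lt v hv)
        simp only [h1, hvm, if_false, true_and]
        omega
    · left
      rcases h.mate v hv hv2 hvm with h1 | h1
      · have : μ v ≠ y := fun h' => hy1 (h' ▸ h1)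
        simp [h1, this]
      · simp [h1.1]

/-! ### The matching and the alternating walk as commands. -/

namespace RAM

open Cmd

/-! Registers: `16` the point to be decided next, `17` the other point of its cluster. Arrays: `6`
the partners in the matching, `7` the colors of the points. -/

/-- Match every inner vertex of the tree with its parent or one of its children. -/
def matchTree : Cmd :=
  seq (fill 6 11 (.var 11)) (loop 9 (ite
    (.and (.lt (.add (.var 9) (.lit 1)) (.var 3))
      (.eq (.arr 6 (.arr 2 (.var 9))) (.arr 2 (.var 9))))
    (seq (store 6 (.arr 2 (.var 9)) (.arr 3 (.var 9)))
      (store 6 (.arr 3 (.var 9)) (.arr 2 (.var 9)))) skip))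

/-- Greedy matching in insertion order works because edge `i` introduces the child `o (i + 1)`,
while before round `i` only points among `o 0, …, o i` are matched. A parent still unmatched can
thus always take this child. -/
lemma matchTree_spec {d : ℕ → ℕ → ℝ} {n : ℕ} {E : Set ℕ} {r : ℕ} {lam : ℝ} {s : State}
    (h0 : s.reg 0 = n) (hE : ∀ v ∈ E, v < n) (hsymm : ∀ u v, d u v = d v u)
    (hg : Grown d E r (s.arr 1) (s.arr 2) (s.arr 3) (s.reg 3) lam) (hk : s.reg 3 ≤ n) :
    TreeMatching d n (s.arr 1) (s.arr 2) (s.reg 3) lam ((matchTree.eval d s).arr 6) := by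
  have hfill := eval_fill (d := d) (a := 6) (v := 11) (e := .var 11) (s := s) id
    (fun t _ _ => rfl)
  rw [matchTree, eval_seq]
  have f0 := eval_reg (d := d) (y := 0) (fill 6 11 (.var 11)) (by decide) s
  have f3 := eval_reg (d := d) (y := 3) (fill 6 11 (.var 11)) (by decide) s
  have fa : ∀ a, a ≠ 6 → ((fill 6 11 (.var 11)).eval d s).arr a = s.arr a := fun a ha =>
    eval_arr _ (by simpa [fill, arrs] using ha) s
  set s₁ := (fill 6 11 (.var 11)).eval d s
  rw [h0] at f0 hfill
  set o := s.arr 1 with ho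
  set k := s.reg 3 with hk'
  have hon : ∀ i < k, o i < n := fun i hi => hE _ (hg.mem i hi)
  suffices h : (∀ v < n, ((_ : State).arr 6 v < n)) ∧ _ ∧ _ ∧
      (∀ v < n, ((_ : State).arr 6 v ≠ v → ∃ j < k, j ≤ s₁.reg 0 ∧ o j = v)) ∧
      (∀ e < s₁.reg 0, e + 1 < k → (_ : State).arr 6 (s.arr 2 e) ≠ s.arr 2 e) from
    ⟨h.1, h.2.1, h.2.2.1, fun v hv hm => (h.2.2.2.1 v hv hm).imp fun j hj => ⟨hj.1, hj.2.2⟩,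
      fun e he => h.2.2.2.2 e (by omega) he⟩
  refine eval_loop (I := fun i t => (∀ v < n, t.arr 6 v < n) ∧ (∀ v < n, t.arr 6 (t.arr 6 v) = v) ∧
    (∀ v < n, t.arr 6 v ≠ v → d v (t.arr 6 v) ≤ lam) ∧
    (∀ v < n, t.arr 6 v ≠ v → ∃ j < k, j ≤ i ∧ o j = v) ∧
    (∀ e < i, e + 1 < k → t.arr 6 (s.arr 2 e) ≠ s.arr 2 e)) ?_ ?_ ?_
  · intro i t v h; exact h
  · refine ⟨fun v hv => ?_, fun v hv => ?_, fun v hv hm => ?_, fun v hv hm => ?_, by simp⟩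
    · rw [hfill v hv]; exact hv
    · simp [hfill v hv]
    · exact absurd (hfill v hv) hm
    · exact absurd (hfill v hv) hm
  · rintro i hi t hti hr ha ⟨hlt, hinv, hle, hmem, hinn⟩
    have t3 : t.reg 3 = k := (hr 3 (by decide)).trans f3
    have ta : ∀ a, a ≠ 6 → t.arr a = s.arr a := fun a h =>
      (ha a (by simpa [arrs] using h)).trans (fa a h)
    have t2 := ta 2 (by decide)
    have t3' := ta 3 (by decide)
    by_cases hb : i + 1 < k ∧ t.arr 6 (s.arr 2 i) = s.arr 2 i
    · rw [eval_ite_pos (by simpa [Cond.Holds, Expr.eval, hti, t3, t2] using hb)]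
      obtain ⟨hik, hpp⟩ := hb
      obtain ⟨j, hj, hj'⟩ := hg.fst i hik
      have hc := hg.snd i hik
      have hpc := hg.le i hik
      set p := s.arr 2 i
      set c := s.arr 3 i
      have hp : p < n := hj' ▸ hon j (by omega)
      have hcn : c < n := hc ▸ hon _ hik
      have hne : c ≠ p := by
        rw [hc, hj']; intro h
        have := hg.inj _ hik _ (by omega) h
        omega
      have hcc : t.arr 6 c = c := by
        by_contra h
        obtain ⟨l, hl, hli, hl'⟩ := hmem c hcn h
        have := hg.inj _ hl _ hik (hl'.trans hc)
        omega
      have h6 : ((seq (store 6 (.arr 2 (.var 9)) (.arr 3 (.var 9)))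
          (store 6 (.arr 3 (.var 9)) (.arr 2 (.var 9)))).eval d t).arr 6 =
          fun v => if v = c then p else if v = p then c else t.arr 6 v := by
        simp [eval, Expr.eval, funext_iff, hti, t2, t3', p, c]
      rw [h6]
      have hcases : ∀ v, v ≠ c → v ≠ p → v < n → t.arr 6 v ≠ c ∧ t.arr 6 v ≠ p := by
        intro v h1 h2 hv
        constructor
        · intro h; have := hinv v hv; rw [h, hcc] at this; exact h1 this.symm
        · intro h; have := hinv v hv; rw [h, hpp] at this; exact h2 this.symm
      refine ⟨fun v hv => ?_, fun v hv => ?_, fun v hv => ?_, fun v hv => ?_, fun e he hek => ?_⟩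
      · dsimp only; split_ifs
        exacts [hp, hcn, hlt v hv]
      · by_cases h1 : v = c
        · simp [h1]
        · by_cases h2 : v = p
          · simp [h2]
          · simp [h1, h2, hcases v h1 h2 hv, hinv v hv]
      · dsimp only; split_ifs with h1 h2
        · intro _; rw [h1, hsymm]; exact hpc
        · intro _; rw [h2]; exact hpc
        · exact hle v hv
      · dsimp only; split_ifs with h1 h2
        · intro _; exact ⟨i + 1, hik, le_rfl, by rw [h1, hc]⟩
        · intro _; exact ⟨j, by omega, by omega, by rw [h2, hj']⟩
        · intro h
          obtain ⟨l, h3, h4, h5⟩ := hmem v hv h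
          exact ⟨l, h3, by omega, h5⟩
      · dsimp only; split_ifs with h1 h2
        · rw [h1]; exact hne.symm
        · rw [h2]; exact hne
        · have : e ≠ i := fun h => h2 (by rw [h])
          exact hinn e (by omega) hek
    · rw [eval_ite_neg (by simpa [Cond.Holds, Expr.eval, hti, t3, t2] using hb)]
      refine ⟨hlt, hinv, hle, fun v hv h => ?_, fun e he hek => ?_⟩
      · obtain ⟨l, h3, h4, h5⟩ := hmem v hv h
        exact ⟨l, h3, by omega, h5⟩
      · by_cases h : e = i
        · subst h
          exact fun h => hb ⟨hek, h⟩
        · exact hinn e (by omega) hek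

/-- Choose an undecided point, reject the other point of its cluster, and continue with the partner
of the rejected point. -/
def colorStep : Cmd :=
  seq (ite (.eq (.arr 7 (.var 16)) (.lit 0)) skip (find 16 11 (.eq (.arr 7 (.var 11)) (.lit 0))))
    (ite (.eq (.arr 7 (.var 16)) (.lit 0))
      (seq (set 17 (.var 16)) (seq
        (find 17 11 (.and (.not (.eq (.var 11) (.var 16)))
          (.eq (.arr 0 (.var 11)) (.arr 0 (.var 16))))) (seq
        (store 7 (.var 17) (.lit 2)) (seq (store 7 (.var 16) (.lit 1))
          (set 16 (.arr 6 (.var 17))))))) skip)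

/-- The last clause measures progress: every step either decides a new point or finds none
undecided. -/
lemma colorStep_spec {d : ℕ → ℕ → ℝ} {n : ℕ} {cl : ℕ → ℕ} {o a : ℕ → ℕ} {k : ℕ} {lam : ℝ}
    {s : State} (h0 : s.reg 0 = n) (hcl : ∀ v < n, s.arr 0 v = cl v)
    (hsize : ∀ u < n, ∀ v < n, ∀ w < n, v ≠ u → w ≠ u → cl v = cl u → cl w = cl u → v = w)
    (hμ : TreeMatching d n o a k lam (s.arr 6))
    (h : Coloring n cl (firstValues o k) (s.arr 6) (s.arr 7) (s.reg 16)) :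
    let t := colorStep.eval d s
    Coloring n cl (firstValues o k) (s.arr 6) (t.arr 7) (t.reg 16) ∧
      (∀ v < n, s.arr 7 v ≠ 0 → t.arr 7 v ≠ 0) ∧
      ((∀ v < n, t.arr 7 v ≠ 0) ∨ ∃ v < n, s.arr 7 v = 0 ∧ t.arr 7 v ≠ 0) := by
  intro t
  simp only [t, colorStep]
  rw [eval_seq]
  obtain ⟨s₁, hs₁, h₁, a₁, r₁, hzero⟩ : ∃ s₁ : State,
      (ite (.eq (.arr 7 (.var 16)) (.lit 0)) skip
        (find 16 11 (.eq (.arr 7 (.var 11)) (.lit 0)))).eval d s = s₁ ∧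
      Coloring n cl (firstValues o k) (s.arr 6) (s.arr 7) (s₁.reg 16) ∧
      s₁.arr = s.arr ∧ s₁.reg 0 = n ∧ (s.arr 7 (s₁.reg 16) ≠ 0 → ∀ v < n, s.arr 7 v ≠ 0) := by
    refine ⟨_, rfl, ?_⟩
    by_cases hb : s.arr 7 (s.reg 16) = 0
    · rw [eval_ite_pos (by simpa [Cond.Holds, Expr.eval] using hb)]
      exact ⟨h, rfl, h0, fun h => absurd hb h⟩
    · rw [eval_ite_neg (by simpa [Cond.Holds, Expr.eval] using hb)]
      have hf := eval_find (d := d) (x := 16) (v := 11) (b := .eq (.arr 7 (.var 11)) (.lit 0))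
        (s := s) (by decide) (fun v => s.arr 7 v = 0)
        (fun t _ ht => by simp [Cond.Holds, Expr.eval, ht])
      have f0 := eval_reg (d := d) (y := 0) (find 16 11 (.eq (.arr 7 (.var 11)) (.lit 0)))
        (by decide) s
      have fa : ((find 16 11 (.eq (.arr 7 (.var 11)) (.lit 0))).eval d s).arr = s.arr :=
        funext fun a => eval_arr _ (by simp [find, arrs]) s
      set s₂ := (find 16 11 (.eq (.arr 7 (.var 11)) (.lit 0))).eval d s
      rw [h0] at hf
      -- The walk has ended at a decided point, so no debt is open and a new walk may start
      -- anywhere.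
      have hm : ∀ v < n, s.arr 7 v = 2 → s.arr 6 v ≠ v → s.arr 7 (s.arr 6 v) = 1 :=
        fun v hv h1 h2 => (h.mate v hv h1 h2).resolve_right fun h => hb h.2
      refine ⟨⟨?_, h.le, h.out, h.one, h.two, fun v hv h1 h2 => Or.inl (hm v hv h1 h2)⟩, fa,
        f0.trans h0, fun h1 => ?_⟩
      · rcases hf with hf | hf
        · exact hf.1
        · rw [hf.1]; exact h.lt
      · rcases hf with hf | hf
        · exact absurd hf.2 h1
        · exact hf.2
  rw [hs₁]
  by_cases hb : s.arr 7 (s₁.reg 16) = 0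
  · rw [eval_ite_pos (by simpa [Cond.Holds, Expr.eval, a₁] using hb)]
    rw [eval_seq, eval_seq]
    set s₂ := (set 17 (.var 16)).eval d s₁ with hs₂
    have e16 : s₂.reg 16 = s₁.reg 16 := by simp [hs₂, eval, Expr.eval]
    have e17 : s₂.reg 17 = s₁.reg 16 := by simp [hs₂, eval, Expr.eval]
    have e0 : s₂.reg 0 = n := by simpa [hs₂, eval, Expr.eval] using r₁
    have ea : s₂.arr = s.arr := a₁
    clear_value s₂
    set x := s₁.reg 16
    have hx : x < n := h₁.lt
    have hf := eval_find (d := d) (x := 17) (v := 11) (b := .and (.not (.eq (.var 11) (.var 16)))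
      (.eq (.arr 0 (.var 11)) (.arr 0 (.var 16)))) (s := s₂) (by decide)
      (fun v => v ≠ x ∧ s.arr 0 v = s.arr 0 x)
      (fun t ht ht' => by
        simp [Cond.Holds, Expr.eval, ht', ea, ht 16 (by decide) (by decide), e16])
    have f16 := eval_reg (d := d) (y := 16) (find 17 11 (.and (.not (.eq (.var 11) (.var 16)))
      (.eq (.arr 0 (.var 11)) (.arr 0 (.var 16))))) (by decide) s₂
    have fa : ((find 17 11 (.and (.not (.eq (.var 11) (.var 16)))
      (.eq (.arr 0 (.var 11)) (.arr 0 (.var 16))))).eval d s₂).arr = s₂.arr :=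
        funext fun a => eval_arr _ (by simp [find, arrs]) s₂
    set s₃ := (find 17 11 (.and (.not (.eq (.var 11) (.var 16)))
      (.eq (.arr 0 (.var 11)) (.arr 0 (.var 16))))).eval d s₂
    rw [e0, e17] at hf
    rw [e16] at f16
    rw [ea] at fa
    clear_value s₃
    set y := s₃.reg 17 with hy
    have hyn : y < n := by
      rcases hf with hf | hf
      · exact hf.1
      · rw [hf.1]; exact hx
    have hyx : cl y = cl x := by
      rcases hf with hf | hf
      · rw [← hcl y hyn, ← hcl x hx]; exact hf.2.2
      · rw [hf.1]
    have hun : ∀ w < n, w ≠ x → cl w = cl x → w = y := by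
      intro w hw hwx hwcl
      rcases hf with hf | hf
      · exact hsize x hx w hw y hyn hwx hf.2.1 hwcl hyx
      · exact absurd ⟨hwx, by rw [hcl w hw, hcl x hx]; exact hwcl⟩ (hf.2 w hw)
    have hres := h₁.step hμ hb hyn hyx hun
    simp only [eval_seq]
    -- The rejection is stored before the choice, so for `y = x` the point ends up chosen.
    have h7 : ((set 16 (.arr 6 (.var 17))).eval d ((store 7 (.var 16) (.lit 1)).eval d
        ((store 7 (.var 17) (.lit 2)).eval d s₃))).arr 7 =
        fun v => if v = x then 1 else if v = y then 2 else s.arr 7 v := by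
      simp [eval, Expr.eval, funext_iff, f16, fa, ← hy]
    have h16 : ((set 16 (.arr 6 (.var 17))).eval d ((store 7 (.var 16) (.lit 1)).eval d
        ((store 7 (.var 17) (.lit 2)).eval d s₃))).reg 16 = s.arr 6 y := by
      simp [eval, Expr.eval, fa, ← hy]
    rw [h7, h16]
    refine ⟨hres, fun v hv hv0 => ?_, Or.inr ⟨x, hx, hb, by simp⟩⟩
    dsimp only; split_ifs
    exacts [one_ne_zero, two_ne_zero, hv0]
  · rw [eval_ite_neg (by simpa [Cond.Holds, Expr.eval, a₁] using hb), eval, a₁]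
    exact ⟨h₁, fun v _ => id, Or.inl (hzero hb)⟩

/-- Choose one point from each cluster among the points of the tree, such that every edge of the
matching is hit. -/
def choosePoints : Cmd :=
  seq (fill 7 11 (.add (.sub (.lit 2) (.arr 4 (.var 11))) (.sub (.lit 2) (.arr 4 (.var 11)))))
    (seq (set 16 (.var 2)) (loop 9 colorStep))

/-- The initial color is twice `2 - status`: tree points start undecided, all others rejected. The
number of decided points grows until all are decided, so `n` rounds suffice. -/
lemma choosePoints_spec {d : ℕ → ℕ → ℝ} {n : ℕ} {cl : ℕ → ℕ} {o a : ℕ → ℕ} {k : ℕ} {lam : ℝ}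
    {s : State} (h0 : s.reg 0 = n) (h2 : s.reg 2 < n) (hcl : ∀ v < n, s.arr 0 v = cl v)
    (hsize : ∀ u < n, ∀ v < n, ∀ w < n, v ≠ u → w ≠ u → cl v = cl u → cl w = cl u → v = w)
    (hμ : TreeMatching d n o a k lam (s.arr 6))
    (hin : ∀ v < n, v ∈ firstValues o k → s.arr 4 v = 2)
    (hout : ∀ v < n, v ∉ firstValues o k → s.arr 4 v = 1) :
    let t := choosePoints.eval d s
    (∀ v < n, t.arr 7 v ≠ 0) ∧ ∃ x, Coloring n cl (firstValues o k) (s.arr 6) (t.arr 7) x := by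
  intro t
  simp only [t, choosePoints]
  rw [eval_seq, eval_seq]
  set e : Expr := .add (.sub (.lit 2) (.arr 4 (.var 11))) (.sub (.lit 2) (.arr 4 (.var 11)))
    with he
  have hfill := eval_fill (d := d) (a := 7) (v := 11) (e := e) (s := s)
    (fun v => (2 - s.arr 4 v) + (2 - s.arr 4 v))
    (fun t _ ht => by simp [he, Expr.eval, ht 4 (by decide)])
  have f0 := eval_reg (d := d) (y := 0) (fill 7 11 e) (by decide) s
  have f2 := eval_reg (d := d) (y := 2) (fill 7 11 e) (by decide) s
  have fa : ∀ a, a ≠ 7 → ((fill 7 11 e).eval d s).arr a = s.arr a := fun a ha =>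
    eval_arr _ (by simpa [fill, arrs] using ha) s
  set s₁ := (fill 7 11 e).eval d s
  rw [h0] at f0 hfill
  set s₂ := (set 16 (.var 2)).eval d s₁ with hs₂
  have e0 : s₂.reg 0 = n := by simpa [hs₂, eval, Expr.eval] using f0
  have e16 : s₂.reg 16 = s.reg 2 := by simpa [hs₂, eval, Expr.eval] using f2
  have ea : s₂.arr = s₁.arr := rfl
  clear_value s₂
  set S := firstValues o k with hS
  have hinit : Coloring n cl S (s.arr 6) (s₂.arr 7) (s₂.reg 16) := by
    rw [ea, e16]
    have hc0 : ∀ v < n, v ∈ S → s₁.arr 7 v = 0 := fun v hv hvS => by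
      rw [hfill v hv, hin v hv hvS]
    have hc2 : ∀ v < n, v ∉ S → s₁.arr 7 v = 2 := fun v hv hvS => by
      rw [hfill v hv, hout v hv hvS]
    refine ⟨h2, fun v hv => ?_, hc2, fun v hv w hw h1 => ?_, fun v hv hvS h1 => ?_,
      fun v hv h1 hm => ?_⟩
    · by_cases hvS : v ∈ S
      · rw [hc0 v hv hvS]; omega
      · rw [hc2 v hv hvS]
    · by_cases hvS : v ∈ S
      · rw [hc0 v hv hvS] at h1; omega
      · rw [hc2 v hv hvS] at h1; omega
    · rw [hc0 v hv hvS] at h1; omega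
    · rw [hc0 v hv (hμ.mem v hv hm)] at h1; omega
  have hmain : Coloring n cl S (s.arr 6) (((loop 9 colorStep).eval d s₂).arr 7)
      (((loop 9 colorStep).eval d s₂).reg 16) ∧
      ((∀ v < n, ((loop 9 colorStep).eval d s₂).arr 7 v ≠ 0) ∨ s₂.reg 0 ≤
        ((Finset.range n).filter fun v => ((loop 9 colorStep).eval d s₂).arr 7 v ≠ 0).card) := by
    refine eval_loop (I := fun i t => Coloring n cl S (s.arr 6) (t.arr 7) (t.reg 16) ∧
      ((∀ v < n, t.arr 7 v ≠ 0) ∨ i ≤ ((Finset.range n).filter fun v => t.arr 7 v ≠ 0).card))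
      ?_ ?_ ?_
    · intro i t v h; exact ⟨by simpa using h.1, h.2⟩
    · exact ⟨hinit, Or.inr (by simp)⟩
    · rintro i hi t hti hr ha ⟨hcol, hor⟩
      have ta : ∀ a, a ≠ 7 → t.arr a = s.arr a := fun a h =>
        (ha a (by simpa [arrs, colorStep, find] using h)).trans (ea ▸ fa a h)
      have h6 := ta 6 (by decide)
      have hspec := colorStep_spec (d := d) (cl := cl) (o := o) (a := a) (k := k) (lam := lam)
        (s := t) ((hr 0 (by decide)).trans e0) (by rw [ta 0 (by decide)]; exact hcl) hsize
        (by rw [h6]; exact hμ) (by rw [h6]; exact hcol)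
      rw [h6] at hspec
      obtain ⟨p1, p2, p3⟩ := hspec
      refine ⟨p1, ?_⟩
      rcases p3 with p3 | ⟨x, hx, hx0, hx1⟩
      · exact Or.inl p3
      · rcases hor with hor | hor
        · exact absurd hx0 (hor x hx)
        · refine Or.inr (Nat.succ_le_of_lt (lt_of_le_of_lt hor (Finset.card_lt_card ?_)))
          refine (Finset.ssubset_iff_of_subset ?_).2 ⟨x, by simp [hx, hx1], by simp [hx0]⟩
          intro v hv
          simp only [Finset.mem_filter, Finset.mem_range] at hv ⊢
          exact ⟨hv.1, p2 v hv.1 hv.2⟩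
  rw [e0] at hmain
  obtain ⟨hcol, hor⟩ := hmain
  refine ⟨?_, _, hcol⟩
  rcases hor with hor | hor
  · exact hor
  · intro v hv
    exact Finset.filter_eq_self.1 (Finset.eq_of_subset_of_card_le (Finset.filter_subset _ _)
      (by rw [Finset.card_range]; exact hor)) v (Finset.mem_range.2 hv)

end RAM

/-! ### The best root and the complete algorithm. -/

namespace RAM

open Cmd

/-! Registers: `19` the loop variable for the roots, `20` the best root, `21` and `22` the
endpoints of the longest edge of its tree. -/

/-- Grow a tree from the root by nearest points until it touches all clusters. -/
def growFromAll : Cmd := seq (fill 4 11 (.lit 1)) growTree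

/-- Find the root whose tree has the shortest longest edge. -/
def searchRoot : Cmd :=
  loop 19 (seq (set 2 (.var 19)) (seq growFromAll (ite
    (.and (.lt (.lit 0) (.var 19)) (.not (.distLe (.var 7) (.var 8) (.var 21) (.var 22)))) skip
    (seq (set 20 (.var 19)) (seq (set 21 (.var 7)) (set 22 (.var 8)))))))

/-- The approximation algorithm. -/
def approxTree : Cmd :=
  seq searchRoot (seq (set 2 (.var 20)) (seq growFromAll (seq matchTree (seq choosePoints
    (seq (fill 4 11 (.sub (.lit 2) (.arr 7 (.var 11))))
      (seq (find 2 11 (.eq (.arr 7 (.var 11)) (.lit 1))) growTree))))))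

lemma growFromAll_spec {d : ℕ → ℕ → ℝ} {n : ℕ} {cl : ℕ → ℕ} {r : ℕ} {s : State}
    (h0 : s.reg 0 = n) (h2 : s.reg 2 = r) (hcl : ∀ v < n, s.arr 0 v = cl v) (hr : r < n)
    (hd : d r r = 0) :
    let t := growFromAll.eval d s
    Growing d n cl (Set.Iio n) r t ∧ Covers n cl (firstValues (t.arr 1) (t.reg 3)) := by
  have hfill := eval_fill (d := d) (a := 4) (v := 11) (e := .lit 1) (s := s) (fun _ => 1)
    (fun t _ _ => rfl)
  refine growTree_spec ((eval_reg _ (by decide) s).trans h0) ((eval_reg _ (by decide) s).trans h2)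
    ?_ ?_ (fun v hv => hv) (fun u hu => ⟨u, hu, rfl⟩) hr hd
  · rw [eval_arr _ (by decide)]; exact hcl
  · intro v hv
    rw [hfill v (by omega), if_pos (Set.mem_Iio.2 hv)]

/-- Before the first round the recorded pair means nothing, hence the proviso `0 < i` in the
invariant; root 0 is accepted without comparison. -/
lemma searchRoot_spec {d : ℕ → ℕ → ℝ} {n : ℕ} {cl : ℕ → ℕ} {s : State} (hn : 0 < n)
    (h0 : s.reg 0 = n) (hcl : ∀ v < n, s.arr 0 v = cl v) (hd : ∀ u < n, d u u = 0) :
    let t := searchRoot.eval d s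
    t.reg 20 < n ∧ CutBound d n cl (Set.Iio n) (t.reg 20) (d (t.reg 21) (t.reg 22)) ∧
      ∀ r < n, ∀ lam, CutBound d n cl (Set.Iio n) r lam → d (t.reg 21) (t.reg 22) ≤ lam := by
  have h : (fun i (t : State) => 0 < i → t.reg 20 < n ∧
      CutBound d n cl (Set.Iio n) (t.reg 20) (d (t.reg 21) (t.reg 22)) ∧
      ∀ r < i, ∀ lam, CutBound d n cl (Set.Iio n) r lam → d (t.reg 21) (t.reg 22) ≤ lam)
      (s.reg 0) (searchRoot.eval d s) := by
    refine eval_loop (I := fun i (t : State) => 0 < i → t.reg 20 < n ∧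
      CutBound d n cl (Set.Iio n) (t.reg 20) (d (t.reg 21) (t.reg 22)) ∧
      ∀ r < i, ∀ lam, CutBound d n cl (Set.Iio n) r lam → d (t.reg 21) (t.reg 22) ≤ lam) ?_ ?_ ?_
    · intro i t v h; simpa using h
    · simp
    · intro i hi t hti hr ha ih _
      rw [h0] at hi
      rw [eval_seq, eval_seq]
      set t₁ := (set 2 (.var 19)).eval d t with ht₁
      have e2 : t₁.reg 2 = i := by simpa [ht₁, eval, Expr.eval] using hti
      have e0 : t₁.reg 0 = n := by
        simpa [ht₁, eval, Expr.eval] using (hr 0 (by decide)).trans h0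
      have e19 : t₁.reg 19 = i := by simpa [ht₁, eval, Expr.eval] using hti
      have e20 : t₁.reg 20 = t.reg 20 := by simp [ht₁, eval, Expr.eval]
      have e21 : t₁.reg 21 = t.reg 21 := by simp [ht₁, eval, Expr.eval]
      have e22 : t₁.reg 22 = t.reg 22 := by simp [ht₁, eval, Expr.eval]
      have ecl : ∀ v < n, t₁.arr 0 v = cl v := by
        intro v hv
        rw [← hcl v hv, ← ha 0 (by decide)]; rfl
      clear_value t₁
      obtain ⟨hg, hc⟩ := growFromAll_spec e0 e2 ecl hi (hd i hi)
      have f19 := (eval_reg (d := d) growFromAll (y := 19) (by decide) t₁).trans e19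
      have f20 := (eval_reg (d := d) growFromAll (y := 20) (by decide) t₁).trans e20
      have f21 := (eval_reg (d := d) growFromAll (y := 21) (by decide) t₁).trans e21
      have f22 := (eval_reg (d := d) growFromAll (y := 22) (by decide) t₁).trans e22
      set t₂ := growFromAll.eval d t₁
      clear_value t₂
      by_cases hb : 0 < i ∧ ¬ d (t₂.reg 7) (t₂.reg 8) ≤ d (t.reg 21) (t.reg 22)
      · rw [eval_ite_pos (by simpa [Cond.Holds, Expr.eval, f19, f21, f22] using hb), eval, f20, f21,
          f22]
        obtain ⟨h1, h2, h3⟩ := ih hb.1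
        refine ⟨h1, h2, fun r hr lam hl => ?_⟩
        rcases Nat.lt_succ_iff_lt_or_eq.1 hr with hr | rfl
        · exact h3 r hr lam hl
        · exact (not_le.1 hb.2).le.trans (hg.le_of_cutBound lam hl)
      · rw [eval_ite_neg (by simpa [Cond.Holds, Expr.eval, f19, f21, f22] using hb)]
        simp only [eval_seq, eval_set, Expr.eval, State.setReg_reg, Nat.reduceEqDiff, if_true,
          if_false, f19]
        refine ⟨hi, hg.grown.cutBound hc hg.nonneg, fun r hr lam hl => ?_⟩
        rcases Nat.lt_succ_iff_lt_or_eq.1 hr with hr | rfl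
        · have hle : d (t₂.reg 7) (t₂.reg 8) ≤ d (t.reg 21) (t.reg 22) := by
            by_contra h; exact hb ⟨by omega, h⟩
          exact hle.trans ((ih (by omega)).2.2 r hr lam hl)
        · exact hg.le_of_cutBound lam hl
  rw [h0] at h
  exact h hn

/-- The approximation algorithm finds a tree on one point of each cluster, whose longest edge is at
most three times as long as necessary. -/
theorem approxTree_spec {d : ℕ → ℕ → ℝ} {n : ℕ} {cl : ℕ → ℕ} {s : State} (hn : 0 < n)
    (h0 : s.reg 0 = n) (hcl : ∀ v < n, s.arr 0 v = cl v) (hd : ∀ u < n, d u u = 0)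
    (hsymm : ∀ u v, d u v = d v u)
    (htri : ∀ u < n, ∀ v < n, ∀ w < n, d u w ≤ d u v + d v w)
    (hsize : ∀ u < n, ∀ v < n, ∀ w < n, v ≠ u → w ≠ u → cl v = cl u → cl w = cl u → v = w) :
    let t := approxTree.eval d s
    ∃ (C : Set ℕ) (r : ℕ) (lam : ℝ), C ⊆ Set.Iio n ∧
      (∀ u ∈ C, ∀ v ∈ C, cl u = cl v → u = v) ∧
      Grown d C r (t.arr 1) (t.arr 2) (t.arr 3) (t.reg 3) lam ∧
      Covers n cl (firstValues (t.arr 1) (t.reg 3)) ∧ 0 ≤ lam ∧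
      ∀ r' < n, ∀ lam', CutBound d n cl (Set.Iio n) r' lam' → lam ≤ 3 * lam' := by
  classical
  intro t
  obtain ⟨hbest, hcut, hopt⟩ := searchRoot_spec hn h0 hcl hd
  simp only [t, approxTree]
  rw [eval_seq]
  have a0 := eval_reg (d := d) searchRoot (y := 0) (by decide) s
  have acl : (searchRoot.eval d s).arr 0 = s.arr 0 := eval_arr _ (by decide) s
  set s₁ := searchRoot.eval d s
  clear_value s₁
  rw [eval_seq]
  set s₂ := (set 2 (.var 20)).eval d s₁ with hs₂
  have b0 : s₂.reg 0 = n := by simpa [hs₂, eval, Expr.eval] using a0.trans h0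
  have b2 : s₂.reg 2 = s₁.reg 20 := by simp [hs₂, eval, Expr.eval]
  have bcl : s₂.arr 0 = s.arr 0 := acl
  clear_value s₂
  set best := s₁.reg 20
  obtain ⟨hg, hcov⟩ := growFromAll_spec (d := d) (cl := cl) b0 b2 (by rw [bcl]; exact hcl) hbest
    (hd _ hbest)
  rw [eval_seq]
  have c0 := (eval_reg (d := d) growFromAll (y := 0) (by decide) s₂).trans b0
  have c2 := (eval_reg (d := d) growFromAll (y := 2) (by decide) s₂).trans b2
  have ccl := (eval_arr (d := d) growFromAll (a := 0) (by decide) s₂).trans bcl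
  set s₃ := growFromAll.eval d s₂
  clear_value s₃
  set o := s₃.arr 1
  set k := s₃.reg 3
  set lam := d (s₃.reg 7) (s₃.reg 8) with hlam
  -- The tree of the best root is grown anew, and its bottleneck is bounded by the recorded one
  -- through `CutBound`, without comparing the two runs.
  have hlam_le := hg.le_of_cutBound _ hcut
  have hμ := matchTree_spec c0 (fun v hv => hv) hsymm hg.grown (hg.size_le fun v hv => hv)
  rw [eval_seq]
  have d0 := (eval_reg (d := d) matchTree (y := 0) (by decide) s₃).trans c0
  have d2 := (eval_reg (d := d) matchTree (y := 2) (by decide) s₃).trans c2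
  have dcl := (eval_arr (d := d) matchTree (a := 0) (by decide) s₃).trans ccl
  have d4 := eval_arr (d := d) matchTree (a := 4) (by decide) s₃
  set s₄ := matchTree.eval d s₃
  clear_value s₄
  obtain ⟨hc0, x, hcol⟩ := choosePoints_spec (d := d) (cl := cl) d0 (by rw [d2]; exact hbest)
    (by rw [dcl]; exact hcl) hsize hμ (fun v hv h => by rw [d4]; exact (hg.status v hv).2 h)
    (fun v hv h => by rw [d4]; exact (hg.eligible v hv).2 ⟨hv, h⟩)
  rw [eval_seq]
  have e0 := (eval_reg (d := d) choosePoints (y := 0) (by decide) s₄).trans d0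
  have ecl := (eval_arr (d := d) choosePoints (a := 0) (by decide) s₄).trans dcl
  set s₅ := choosePoints.eval d s₄
  clear_value s₅
  have hc12 : ∀ v < n, s₅.arr 7 v = 1 ∨ s₅.arr 7 v = 2 := by
    intro v hv
    have := hcol.le v hv
    have := hc0 v hv
    omega
  set C : Set ℕ := {v | v < n ∧ s₅.arr 7 v = 1} with hC
  have hCS : C ⊆ firstValues o k := by
    rintro v ⟨hv, hv1⟩
    by_contra h
    have := hcol.out v hv h
    omega
  have hCcov : Covers n cl C := by
    intro u hu
    obtain ⟨v, hv, hvu⟩ := hcov u hu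
    have hvn : v < n := by
      obtain ⟨i, hi, rfl⟩ := hv
      exact hg.grown.mem i hi
    rcases hc12 v hvn with h | h
    · exact ⟨v, ⟨hvn, h⟩, hvu⟩
    · obtain ⟨w, hw, h1, h2⟩ := hcol.two v hvn hv h
      exact ⟨w, ⟨hw, h1⟩, h2.trans hvu⟩
  have hCuniq : ∀ u ∈ C, ∀ v ∈ C, cl u = cl v → u = v := by
    intro u hu v hv h
    by_contra huv
    have := hcol.one u hu.1 v hv.1 hu.2 (Ne.symm huv) h.symm
    have := hv.2
    omega
  have hit : ∀ v < n, s₄.arr 6 v ≠ v → v ∈ C ∨ s₄.arr 6 v ∈ C := by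
    intro v hv hm
    rcases hc12 v hv with h | h
    · exact Or.inl ⟨hv, h⟩
    -- No point is undecided any more, so the exceptional clause of `mate` is void.
    · refine Or.inr ⟨hμ.lt v hv, (hcol.mate v hv h hm).resolve_right fun h' => ?_⟩
      exact hc0 x hcol.lt h'.2
  have hcutC := fun r' => hμ.cutBound (cl := cl) hg.grown (fun v hv => hv) hg.nonneg hd hsymm htri
    hCS hCcov hit r'
  rw [eval_seq]
  have hfill := eval_fill (d := d) (a := 4) (v := 11) (e := .sub (.lit 2) (.arr 7 (.var 11)))
    (s := s₅) (fun v => 2 - s₅.arr 7 v) (fun t _ ht => by simp [Expr.eval, ht 7 (by decide)])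
  have f0 := (eval_reg (d := d) (fill 4 11 (.sub (.lit 2) (.arr 7 (.var 11)))) (y := 0) (by decide)
    s₅).trans e0
  have fcl := (eval_arr (d := d) (fill 4 11 (.sub (.lit 2) (.arr 7 (.var 11)))) (a := 0)
    (by decide) s₅).trans ecl
  have f7 := eval_arr (d := d) (fill 4 11 (.sub (.lit 2) (.arr 7 (.var 11)))) (a := 7)
    (by decide) s₅
  set s₆ := (fill 4 11 (.sub (.lit 2) (.arr 7 (.var 11)))).eval d s₅
  clear_value s₆
  rw [e0] at hfill
  rw [eval_seq]
  have hfind := eval_find (d := d) (x := 2) (v := 11) (b := .eq (.arr 7 (.var 11)) (.lit 1))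
    (s := s₆) (by decide) (fun v => s₅.arr 7 v = 1)
    (fun t _ ht => by simp [Cond.Holds, Expr.eval, ht, f7])
  have g0 := (eval_reg (d := d) (find 2 11 (.eq (.arr 7 (.var 11)) (.lit 1))) (y := 0) (by decide)
    s₆).trans f0
  have gcl := (eval_arr (d := d) (find 2 11 (.eq (.arr 7 (.var 11)) (.lit 1))) (a := 0)
    (by decide) s₆).trans fcl
  have g4 := eval_arr (d := d) (find 2 11 (.eq (.arr 7 (.var 11)) (.lit 1))) (a := 4)
    (by decide) s₆
  set s₇ := (find 2 11 (.eq (.arr 7 (.var 11)) (.lit 1))).eval d s₆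
  clear_value s₇
  rw [f0] at hfind
  have hroot : s₇.reg 2 ∈ C := by
    rcases hfind with h | h
    · exact h
    · obtain ⟨v, hv, _⟩ := hCcov 0 hn
      exact absurd hv.2 (h.2 v hv.1)
  obtain ⟨hg', hcov'⟩ := growTree_spec (d := d) (n := n) (cl := cl) (E := C) g0 rfl
    (by rw [gcl]; exact hcl)
    (by
      intro v hv
      rw [g4, hfill v hv]
      rcases hc12 v hv with h | h <;> simp [hC, hv, h])
    (fun v hv => hv.1) hCcov hroot (hd _ hroot.1)
  refine ⟨C, _, _, fun v hv => hv.1, hCuniq, hg'.grown, hcov', hg'.nonneg, fun r' hr' lam' hl => ?_⟩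
  have h1 := hg'.le_of_cutBound _ (hcutC _)
  have h2 := hopt r' hr' lam' hl
  linarith

end RAM

/-! ### Translation between metric instances and tables. -/

namespace GBST

variable {k : ℕ} {X : Type*} [MetricSpace X]

lemma distTable_apply (I : GBST k X) (p q : Fin I.n) :
    I.distTable p q = dist (I.pt p) (I.pt q) := by
  simp [distTable]

lemma distTable_comm (I : GBST k X) (p q : ℕ) : I.distTable p q = I.distTable q p := by
  unfold distTable
  by_cases h : p < I.n ∧ q < I.n
  · rw [dif_pos h, dif_pos h.symm, dist_comm]
  · rw [dif_neg h, dif_neg fun h' => h h'.symm]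

lemma bottleneck_nonneg (I : GBST k X) (T : I.Graph) : 0 ≤ I.bottleneck T :=
  Real.sSup_nonneg (by rintro r ⟨a, b, -, rfl⟩; exact dist_nonneg)

lemma dist_le_bottleneck (I : GBST k X) (T : I.Graph) {a b : Fin I.n} (h : T.Adj a b) :
    dist (I.pt a) (I.pt b) ≤ I.bottleneck T := by
  refine le_csSup (Set.Finite.bddAbove ?_) ⟨a, b, h, rfl⟩
  refine (Set.finite_range fun p : Fin I.n × Fin I.n => dist (I.pt p.1) (I.pt p.2)).subset ?_
  rintro r ⟨a, b, -, rfl⟩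
  exact ⟨(a, b), rfl⟩

lemma input_arr_zero (I : GBST k X) (i : Fin I.n) : I.input.arr 0 i = I.cluster i := by
  simp [input]

/-- A feasible tree bounds the lengths of the edges that are needed to touch all clusters from one
of its vertices. -/
lemma IsFeasible.exists_cutBound {I : GBST k X} {T : I.Graph} (h : I.IsFeasible T) :
    ∃ r < I.n, CutBound I.distTable I.n (I.input.arr 0) (Set.Iio I.n) r (I.bottleneck T) := by
  obtain ⟨htree, hv⟩ := h
  obtain ⟨r⟩ := htree.connected.nonempty
  refine ⟨r.1, r.1.2, I.bottleneck_nonneg T, fun S _ hr hS => ?_⟩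
  have : ∃ u : Fin I.n, ∀ v ∈ S, I.input.arr 0 v ≠ I.input.arr 0 u := by
    by_contra! h
    exact hS fun u hu => h ⟨u, hu⟩
  obtain ⟨u, hu⟩ := this
  obtain ⟨w, ⟨hwT, hwu⟩, -⟩ := hv (I.cluster u)
  have hwS : (w : ℕ) ∉ S := fun hw => hu w hw (by rw [input_arr_zero, input_arr_zero, hwu])
  obtain ⟨p⟩ := htree.connected.preconnected r ⟨w, hwT⟩
  -- The tree walk from the root to its vertex in an untouched cluster must leave `S` along a tree
  -- edge.
  obtain ⟨e, -, h1, h2⟩ := p.exists_boundary_dart {x | ((x : Fin I.n) : ℕ) ∈ S} hr hwS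
  refine ⟨_, h1, _, e.snd.1.2, h2, ?_⟩
  rw [distTable_apply]
  exact I.dist_le_bottleneck T e.adj

/-- The graph that is described by lists of vertices and of edges. -/
def listGraph (I : GBST k X) (o a b : ℕ → ℕ)
    (hne : ∀ e, e + 1 < I.m → a e ≠ b e)
    (hmem : ∀ e, e + 1 < I.m → (∃ j < I.m, o j = a e) ∧ ∃ j < I.m, o j = b e) : I.Graph where
  verts := {v | ∃ j < I.m, o j = v}
  Adj u v := ∃ e, e + 1 < I.m ∧ ((a e = u ∧ b e = v) ∨ (a e = v ∧ b e = u))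
  adj_sub := by
    rintro u v ⟨e, he, h⟩
    rw [SimpleGraph.top_adj]
    rintro rfl
    have := hne e he
    rcases h with h | h <;> exact this (h.1.trans h.2.symm)
  edge_vert := by
    rintro u v ⟨e, he, h | h⟩
    · obtain ⟨j, hj, hj'⟩ := (hmem e he).1
      exact ⟨j, hj, hj'.trans h.1⟩
    · obtain ⟨j, hj, hj'⟩ := (hmem e he).2
      exact ⟨j, hj, hj'.trans h.2⟩
  symm := ⟨by rintro u v ⟨e, he, h⟩; exact ⟨e, he, h.symm⟩⟩

/-- A grown tree with one point in each cluster describes a feasible tree. -/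
lemma exists_isFeasible (I : GBST k X) {C : Set ℕ} {r : ℕ} {o a b : ℕ → ℕ} {l : ℕ} {lam : ℝ}
    (hC : C ⊆ Set.Iio I.n)
    (huniq : ∀ u ∈ C, ∀ v ∈ C, I.input.arr 0 u = I.input.arr 0 v → u = v)
    (hg : Grown I.distTable C r o a b l lam)
    (hcov : Covers I.n (I.input.arr 0) (firstValues o l)) (h0 : 0 ≤ lam) :
    ∃ T : I.Graph, (∀ v : Fin I.n, v ∈ T.verts ↔ ∃ j < I.m, o j = v) ∧
      (∀ u v : Fin I.n, T.Adj u v ↔ ∃ e, e + 1 < I.m ∧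
        ((a e = u ∧ b e = v) ∨ (a e = v ∧ b e = u))) ∧
      I.IsFeasible T ∧ I.bottleneck T ≤ lam := by
  have hon : ∀ i < l, o i < I.n := fun i hi => hC (hg.mem i hi)
  -- the clusters are in bijection with the vertices
  have hl : l = I.m := by
    have hbij : Function.Bijective fun i : Fin l => I.cluster ⟨o i, hon i i.2⟩ := by
      constructor
      · intro i j hij
        have := huniq _ (hg.mem i i.2) _ (hg.mem j j.2) (by
          have h1 := I.input_arr_zero ⟨o i, hon i i.2⟩
          have h2 := I.input_arr_zero ⟨o j, hon j j.2⟩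
          simp only at hij h1 h2
          rw [h1, h2, hij])
        exact Fin.ext (hg.inj i i.2 j j.2 this)
      · intro j
        obtain ⟨u, rfl⟩ := I.cluster_nonempty j
        obtain ⟨v, ⟨i, hi, rfl⟩, hv⟩ := hcov u u.2
        refine ⟨⟨i, hi⟩, Fin.ext ?_⟩
        have h1 := I.input_arr_zero ⟨o i, hon i hi⟩
        have h2 := I.input_arr_zero u
        simp only at h1 ⊢
        rw [← h1, hv, h2]
    simpa using Fintype.card_of_bijective hbij
  subst hl
  have hmem : ∀ e, e + 1 < I.m → (∃ j < I.m, o j = a e) ∧ ∃ j < I.m, o j = b e := by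
    intro e he
    obtain ⟨j, hj, hj'⟩ := hg.fst e he
    exact ⟨⟨j, by omega, hj'.symm⟩, ⟨e + 1, he, (hg.snd e he).symm⟩⟩
  have hne : ∀ e, e + 1 < I.m → a e ≠ b e := by
    intro e he h
    obtain ⟨j, hj, hj'⟩ := hg.fst e he
    rw [hj', hg.snd e he] at h
    have := hg.inj _ (by omega) _ he h
    omega
  set T := I.listGraph o a b hne hmem with hT
  have hTv : ∀ v : Fin I.n, v ∈ T.verts ↔ ∃ j < I.m, o j = v := fun v => Iff.rfl
  have hTa : ∀ u v : Fin I.n, T.Adj u v ↔ ∃ e, e + 1 < I.m ∧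
      ((a e = u ∧ b e = v) ∨ (a e = v ∧ b e = u)) := fun u v => Iff.rfl
  refine ⟨T, hTv, hTa, ⟨?_, ?_⟩, ?_⟩
  · let w : Fin I.m → T.verts := fun i => ⟨⟨o i, hon i i.2⟩, ⟨i, i.2, rfl⟩⟩
    have hw : Function.Bijective w := by
      constructor
      · intro i j hij
        exact Fin.ext (hg.inj i i.2 j j.2 
          (congrArg (fun x : T.verts => ((x : Fin I.n) : ℕ)) hij))
      · rintro ⟨v, i, hi, hv⟩
        exact ⟨⟨i, hi⟩, Subtype.ext (Fin.ext hv)⟩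
    have hpar : ∀ e (he : e + 1 < I.m), ∃ j, ∃ (hj : j ≤ e),
        T.coe.Adj (w ⟨j, by omega⟩) (w ⟨e + 1, he⟩) ∧ a e = o j := by
      intro e he
      obtain ⟨j, hj, hj'⟩ := hg.fst e he
      exact ⟨j, hj, ⟨e, he, Or.inl ⟨hj', hg.snd e he⟩⟩, hj'⟩
    have hreach : ∀ i (hi : i < I.m), T.coe.Reachable (w ⟨0, hg.pos⟩) (w ⟨i, hi⟩) := by
      intro i
      induction i using Nat.strong_induction_on with
      | _ i ih =>
        intro hi
        rcases i with _ | e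
        · exact SimpleGraph.Reachable.refl _
        · obtain ⟨j, hj, hadj, -⟩ := hpar e hi
          exact (ih j (by omega) (by omega)).trans hadj.reachable
    have hconn : T.coe.Connected := by
      rw [SimpleGraph.connected_iff_exists_forall_reachable]
      refine ⟨w ⟨0, hg.pos⟩, fun v => ?_⟩
      obtain ⟨i, rfl⟩ := hw.2 v
      exact hreach i i.2
    rw [SimpleGraph.isTree_iff_connected_and_card]
    -- Connectedness gives one inequality of the edge count; for the other, the `m - 1` listed pairs
    -- exhaust the edges.
    refine ⟨hconn, le_antisymm ?_ hconn.card_vert_le_card_edgeSet_add_one⟩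
    rw [← Nat.card_congr (Equiv.ofBijective w hw), Nat.card_fin]
    have hedge : ∀ e : Fin (I.m - 1), ∃ j, ∃ (hj : j ≤ e.1),
        T.coe.Adj (w ⟨j, by omega⟩) (w ⟨e + 1, by omega⟩) ∧ a e = o j := fun e => hpar e (by omega)
    choose j hj hadj hja using hedge
    have hsurj : Function.Surjective fun e : Fin (I.m - 1) =>
        (⟨s(w ⟨j e, by have := hj e; omega⟩, w ⟨e + 1, by omega⟩), hadj e⟩ : T.coe.edgeSet) := by
      rintro ⟨p, hp⟩
      induction p using Sym2.ind with
      | _ u v =>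
        obtain ⟨e, he, h⟩ := (hp : T.coe.Adj u v)
        have hb := hg.snd e he
        have ha := hja ⟨e, by omega⟩
        simp only at ha
        refine ⟨⟨e, by omega⟩, Subtype.ext ?_⟩
        simp only [Sym2.eq_iff]
        rcases h with h | h
        · exact Or.inl ⟨Subtype.ext (Fin.ext (ha.symm.trans h.1)),
            Subtype.ext (Fin.ext (hb.symm.trans h.2))⟩
        · exact Or.inr ⟨Subtype.ext (Fin.ext (ha.symm.trans h.1)),
            Subtype.ext (Fin.ext (hb.symm.trans h.2))⟩
    have hcard : Nat.card T.coe.edgeSet ≤ _ := Nat.card_le_card_of_surjective _ hsurj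
    rw [Nat.card_fin] at hcard
    have := hg.pos
    omega
  · intro c
    obtain ⟨u, rfl⟩ := I.cluster_nonempty c
    obtain ⟨v, ⟨i, hi, rfl⟩, hv⟩ := hcov u u.2
    have h1 := I.input_arr_zero ⟨o i, hon i hi⟩
    have h2 := I.input_arr_zero u
    simp only at h1
    refine ⟨⟨o i, hon i hi⟩, ⟨⟨i, hi, rfl⟩, Fin.ext (by rw [← h1, hv, h2])⟩, ?_⟩
    rintro y ⟨⟨j, hj, hy⟩, hyu⟩
    refine Fin.ext (huniq _ ?_ _ (hg.mem i hi) ?_)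
    · rw [← hy]; exact hg.mem j hj
    · rw [hv, h2, input_arr_zero, hyu]
  · refine Real.sSup_le ?_ h0
    rintro x ⟨u, v, ⟨e, he, h⟩, rfl⟩
    have hle := hg.le e he
    rcases h with h | h
    · rw [h.1, h.2, distTable_apply] at hle; exact hle
    · rw [h.1, h.2, distTable_apply, dist_comm] at hle; exact hle

end GBST

/-- There is a polynomial-time 3-approximation algorithm for the 2-generalized bottleneck spanning
tree problem in metric spaces. -/
theorem theorem6 :
    ∃ (P : RAM.Program) (time : Polynomial ℕ),
      ∀ (X : Type*) [MetricSpace X] (I : GBST 2 X),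
        ∃ (t : ℕ) (s : RAM.State) (T : I.Graph),
          RAM.Runs I.distTable P I.input t s ∧ t ≤ time.eval I.n ∧
          I.IsOutput s T ∧ I.IsFeasible T ∧
          ∀ T' : I.Graph, I.IsFeasible T' → I.bottleneck T ≤ 3 * I.bottleneck T' := by
  refine ⟨RAM.approxTree.compile, RAM.approxTree.cost, fun X _ I => ?_⟩
  obtain ⟨t, s, hrun, ht, hs⟩ := RAM.approxTree.runs_compile I.distTable (by decide) I.input I.input
    ⟨rfl, fun _ _ => rfl⟩
  obtain ⟨C, r, lam, hC, huniq, hg, hcov, h0, hopt⟩ := RAM.approxTree_spec (d := I.distTable)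
    (n := I.n) (cl := I.input.arr 0) (s := I.input) I.n_pos rfl (fun _ _ => rfl)
    (fun u hu => by simp [GBST.distTable])
    I.distTable_comm
    (fun u hu v hv w hw => by
      simpa [GBST.distTable, hu, hv, hw] using dist_triangle _ _ _)
    (fun u hu v hv w hw hvu hwu h1 h2 => by
      by_contra hvw
      have e1 := I.input_arr_zero ⟨u, hu⟩
      have e2 := I.input_arr_zero ⟨v, hv⟩
      have e3 := I.input_arr_zero ⟨w, hw⟩
      simp only at e1 e2 e3
      refine absurd (I.cluster_size (I.cluster ⟨u, hu⟩)) (not_le.2 (Finset.two_lt_card.2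
        ⟨⟨u, hu⟩, by simp, ⟨v, hv⟩, ?_, ⟨w, hw⟩, ?_, ?_, ?_, ?_⟩))
      · simp only [Finset.mem_filter, Finset.mem_univ, true_and]
        exact Fin.ext (by rw [← e1, ← e2, h1])
      · simp only [Finset.mem_filter, Finset.mem_univ, true_and]
        exact Fin.ext (by rw [← e1, ← e3, h2])
      · simpa using Ne.symm hvu
      · simpa using Ne.symm hwu
      · simpa using hvw)
  -- The compiled program and the command agree on all arrays, hence on the output.
  rw [← hs.1] at hg hcov
  obtain ⟨T, hv, ha, hT, hle⟩ := I.exists_isFeasible hC huniq hg hcov h0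
  refine ⟨t, s, T, hrun, ht, ⟨hv, ha⟩, hT, fun T' hT' => ?_⟩
  obtain ⟨r', hr', hcut⟩ := hT'.exists_cutBound
  exact hle.trans (hopt r' hr' _ hcut)
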